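/- Let $n\ge 0$, $[n]=\{1,\dots,n\}$, and let $[n]'=\{1',\dots,n'\}$ be a disjoint copy. The partition monoid $\mathcal P_n$ consists of all partitions of $[n]\cup[n]'$; the product $ab$ is obtained by drawing $a$ above $b$, identifying the lower row of $a$ with the upper row of $b$, taking connected components, and deleting the middle row. The partial Brauer monoid $\mathcal{PB}_n$ and the Brauer monoid $\mathcal B_n$ are the submonoids of those partitions all of whose blocks have size at most $2$, respectively exactly $2$. For elements $a,b$ of a monoid $S$ write $a\sim_o b$ if there are $g,h\in S$ with $ag=gb$ and $bh=ha$. For $a$ in a finite monoid, let $a^{\omega}$ be the idempotent among the positive powers of $a$, and $a^{\omega+1}=a^{\omega}a$, which lies in a subgroup. A block of $u\in\mathcal P_n$ is transversal if it meets both $[n]$ and $[n]'$. If $u\in\mathcal P_n$ lies in a subgroup of $\mathcal P_n$, let $\sim_u$ be the smallest equivalence relation on $[n]$ such that $x\sim_u y$ whenever $x,y$ lie in one block of $u$ or $x',y'$ lie in one block of $u$, and let $P_1,\dots,P_m$ be the $\sim_u$-classes that meet some transversal block of $u$. Then there is a unique permutation $\tau_u$ of $\{1,\dots,m\}$ such that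 $\tau_u(i)=j$ if and only if $u$ has a transversal block $A\cup B'$ with $A\subseteq P_i$ and $B\subseteq P_j$. The cycle type of $u$ is $(k_1,k_2,\dots)$, where $k_i$ is the number of cycles of $\tau_u$ of length $i$ (fixed points being cycles of length $1$, and $k_i=0$ for $i>m$). Theorem. (1) Let $a,b\in\mathcal B_n$, and let $a^{\omega+1}$ and $b^{\omega+1}$ have cycle types $(k_i)$ and $(l_i)$. Then $a\sim_o b$ in $\mathcal B_n$ if and only if $k_i\equiv l_i \pmod 2$ for every odd $i$. (2) In $\mathcal P_n$, any two elements are $\sim_o$-related. (3) In $\mathcal{PB}_n$, any two elements are $\sim_o$-related, with conjugators $g,h$ in $\mathcal{PB}_n$. -/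

import Mathlib

/-- An element of the partition monoid on `X`: a partition of `X ∪ X'`, given by its equivalence
relation. The point `x` is `Sum.inl x` (upper row) and the point `x'` is `Sum.inr x`
(lower row). -/
@[ext] structure PartitionMonoid (X : Type*) where
  /-- The equivalence relation on `X ∪ X'` whose classes are the blocks. -/
  rel : Setoid (X ⊕ X)

namespace PartitionMonoid

section Product

variable {X : Type*}

/-- `X ∪ X'` as the top and middle rows of three rows
(top `Sum.inl`, middle `Sum.inr ∘ Sum.inl`, bottom `Sum.inr ∘ Sum.inr`). -/
def upper : X ⊕ X → X ⊕ X ⊕ X := Sum.map id Sum.inl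

/-- `X ∪ X'` as the middle and bottom rows of three rows. -/
def lower : X ⊕ X → X ⊕ X ⊕ X := Sum.inr

/-- `X ∪ X'` as the top and bottom rows of three rows. -/
def outer : X ⊕ X → X ⊕ X ⊕ X := Sum.map id Sum.inr

/-- Adjacency in the three-row graph obtained by drawing `a` over `b` and identifying the lower
row of `a` with the upper row of `b`. -/
inductive Edge (a b : PartitionMonoid X) : X ⊕ X ⊕ X → X ⊕ X ⊕ X → Prop
  | up {z w : X ⊕ X} (h : a.rel z w) : Edge a b (upper z) (upper w)
  | low {z w : X ⊕ X} (h : b.rel z w) : Edge a b (lower z) (lower w)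

/-- The partition of the three rows into connected components of the three-row graph. -/
def stack (a b : PartitionMonoid X) : Setoid (X ⊕ X ⊕ X) := Relation.EqvGen.setoid (Edge a b)

/-- The product `ab`: connect `a` drawn over `b`, then delete the middle row. -/
instance : Mul (PartitionMonoid X) := ⟨fun a b => ⟨(stack a b).comap outer⟩⟩

/-- The identity: the partition with blocks `{x, x'}`. -/
instance : One (PartitionMonoid X) := ⟨⟨Setoid.ker (Sum.elim id id)⟩⟩

lemma mul_rel {a b : PartitionMonoid X} {z w : X ⊕ X} :
    (a * b).rel z w ↔ stack a b (outer z) (outer w) := Iff.rfl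

lemma one_rel {z w : X ⊕ X} :
    (1 : PartitionMonoid X).rel z w ↔ Sum.elim id id z = Sum.elim id id w := Iff.rfl

lemma stack_up {a b : PartitionMonoid X} {z w : X ⊕ X} (h : a.rel z w) :
    stack a b (upper z) (upper w) := Relation.EqvGen.rel _ _ (.up h)

lemma stack_low {a b : PartitionMonoid X} {z w : X ⊕ X} (h : b.rel z w) :
    stack a b (lower z) (lower w) := Relation.EqvGen.rel _ _ (.low h)

lemma Edge.symm {a b : PartitionMonoid X} {v w : X ⊕ X ⊕ X} (h : Edge a b v w) :
    Edge a b w v := by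
  cases h with
  | up h => exact .up (a.rel.symm h)
  | low h => exact .low (b.rel.symm h)

/-- A predicate that is preserved along edges is preserved on connected components. -/
lemma stack_induction {a b : PartitionMonoid X} (Q : X ⊕ X ⊕ X → Prop)
    (hu : ∀ z w, a.rel z w → Q (upper z) → Q (upper w))
    (hl : ∀ z w, b.rel z w → Q (lower z) → Q (lower w))
    {v w : X ⊕ X ⊕ X} (h : stack a b v w) (hv : Q v) : Q w := by
  have key : Q v ↔ Q w := by
    clear hv
    induction h with
    | rel x y h =>
      cases h with
      | up h => exact ⟨hu _ _ h, hu _ _ (a.rel.symm h)⟩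
      | low h => exact ⟨hl _ _ h, hl _ _ (b.rel.symm h)⟩
    | refl => exact Iff.rfl
    | symm _ _ _ ih => exact ih.symm
    | trans _ _ _ _ _ ih1 ih2 => exact ih1.trans ih2
  exact key.1 hv

protected lemma ext_rel {a b : PartitionMonoid X} (h : ∀ z w, a.rel z w ↔ b.rel z w) : a = b :=
  PartitionMonoid.ext (Setoid.ext h)

protected lemma one_mul (a : PartitionMonoid X) : 1 * a = a := by
  refine PartitionMonoid.ext_rel fun z w => ⟨fun h => ?_, fun h => ?_⟩
  · have := stack_induction (a := 1) (b := a)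
      (fun v => a.rel z (Sum.elim Sum.inl id v)) ?_ ?_ (mul_rel.1 h) ?_
    · rcases w with w | w <;> simpa [outer] using this
    · rintro (p | p) (q | q) hpq hp <;> rw [one_rel] at hpq <;> simp [upper] at hpq hp ⊢ <;>
        subst hpq <;> exact hp
    · intro p q hpq hp
      exact a.rel.trans hp hpq
    · rcases z with z | z <;> exact a.rel.refl _
  · have key : ∀ z : X ⊕ X, stack 1 a (outer z) (lower z) := by
      rintro (x | x)
      · exact stack_up (a := 1) (b := a) (z := Sum.inl x) (w := Sum.inr x) (one_rel.2 rfl)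
      · exact (stack 1 a).refl _
    exact (stack 1 a).trans (key z) ((stack 1 a).trans (stack_low h) ((stack 1 a).symm (key w)))

protected lemma mul_one (a : PartitionMonoid X) : a * 1 = a := by
  refine PartitionMonoid.ext_rel fun z w => ⟨fun h => ?_, fun h => ?_⟩
  · have := stack_induction (a := a) (b := 1)
      (fun v => a.rel z (Sum.map id (Sum.elim id id) v)) ?_ ?_ (mul_rel.1 h) ?_
    · rcases w with w | w <;> simpa [outer] using this
    · intro p q hpq hp
      rcases p with p | p <;> rcases q with q | q <;> exact a.rel.trans hp hpq
    · rintro (p | p) (q | q) hpq hp <;> rw [one_rel] at hpq <;> simp [lower] at hpq hp ⊢ <;>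
        subst hpq <;> exact hp
    · rcases z with z | z <;> exact a.rel.refl _
  · have key : ∀ z : X ⊕ X, stack a 1 (outer z) (upper z) := by
      rintro (x | x)
      · exact (stack a 1).refl _
      · exact stack_low (a := a) (b := 1) (z := Sum.inr x) (w := Sum.inl x) (one_rel.2 rfl)
    exact (stack a 1).trans (key z) ((stack a 1).trans (stack_up h) ((stack a 1).symm (key w)))

protected lemma mul_assoc (a b c : PartitionMonoid X) : a * b * c = a * (b * c) := by
  refine PartitionMonoid.ext_rel fun z w => ⟨fun h => ?_, fun h => ?_⟩
  · -- a point in one of the rows of `bc` is reached through a point of its outer rows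
    let S := stack a (b * c)
    let R : X ⊕ X ⊕ X → Prop := fun m => ∃ u, stack b c (outer u) m ∧ S (outer z) (lower u)
    have hR : ∀ u, R (outer u) ↔ S (outer z) (lower u) := fun u =>
      ⟨fun ⟨u', h1, h2⟩ => S.trans h2 (stack_low (mul_rel.2 h1)), fun h => ⟨u, refl _, h⟩⟩
    have hRt : ∀ m m', stack b c m m' → R m → R m' := fun m m' hm ⟨u, h1, h2⟩ =>
      ⟨u, (stack b c).trans h1 hm, h2⟩
    let top : X → Prop := fun x => S (outer z) (Sum.inl x)
    let Q12 : X ⊕ X → Prop := Sum.elim top fun x => R (Sum.inl x)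
    let Q13 : X ⊕ X → Prop := Sum.elim top fun x => R (Sum.inr (Sum.inl x))
    have h12 : ∀ p, Q12 p ↔ S (outer z) (upper p) := by
      rintro (x | x)
      · exact Iff.rfl
      · exact hR (Sum.inl x)
    have hab : ∀ p q, (a * b).rel p q → Q13 p → Q13 q := by
      intro p q hpq hp
      have := stack_induction (a := a) (b := b)
        (Sum.elim top (Sum.elim (fun x => R (Sum.inl x)) fun x => R (Sum.inr (Sum.inl x))))
        ?_ ?_ (mul_rel.1 hpq) ?_
      · rcases q with q | q <;> exact this
      · intro p q hpq hp
        have hp' : Q12 p := by rcases p with p | p <;> exact hp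
        have hq' : Q12 q := (h12 q).2 (S.trans ((h12 p).1 hp') (stack_up hpq))
        rcases q with q | q <;> exact hq'
      · intro p q hpq hp
        have hp' : R (upper p) := by rcases p with p | p <;> exact hp
        have hq' := hRt _ _ (stack_up hpq) hp'
        rcases q with q | q <;> exact hq'
      · rcases p with p | p <;> exact hp
    have := stack_induction (a := a * b) (b := c)
      (Sum.elim top fun p => R (lower p)) ?_ ?_ (mul_rel.1 h) ?_
    · rcases w with w | w
      · exact this
      · exact (hR (Sum.inr w)).1 this
    · intro p q hpq hp
      have hp' : Q13 p := by rcases p with p | p <;> exact hp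
      have hq' := hab p q hpq hp'
      rcases q with q | q <;> exact hq'
    · intro p q hpq hp
      exact hRt _ _ (stack_low hpq) hp
    · rcases z with z | z
      · exact S.refl _
      · exact (hR (Sum.inr z)).2 (S.refl _)
  · -- a point in one of the rows of `ab` is reached through a point of its outer rows
    let S := stack (a * b) c
    let R : X ⊕ X ⊕ X → Prop := fun m => ∃ u, stack a b (outer u) m ∧ S (outer z) (upper u)
    have hR : ∀ u, R (outer u) ↔ S (outer z) (upper u) := fun u =>
      ⟨fun ⟨u', h1, h2⟩ => S.trans h2 (stack_up (mul_rel.2 h1)), fun h => ⟨u, refl _, h⟩⟩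
    have hRt : ∀ m m', stack a b m m' → R m → R m' := fun m m' hm ⟨u, h1, h2⟩ =>
      ⟨u, (stack a b).trans h1 hm, h2⟩
    let bot : X → Prop := fun x => S (outer z) (Sum.inr (Sum.inr x))
    let Q34 : X ⊕ X → Prop := Sum.elim (fun x => R (Sum.inr (Sum.inr x))) bot
    let Q24 : X ⊕ X → Prop := Sum.elim (fun x => R (Sum.inr (Sum.inl x))) bot
    have h34 : ∀ p, Q34 p ↔ S (outer z) (lower p) := by
      rintro (x | x)
      · exact hR (Sum.inr x)
      · exact Iff.rfl
    have hbc : ∀ p q, (b * c).rel p q → Q24 p → Q24 q := by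
      intro p q hpq hp
      have := stack_induction (a := b) (b := c)
        (Sum.elim (fun x => R (Sum.inr (Sum.inl x)))
          (Sum.elim (fun x => R (Sum.inr (Sum.inr x))) bot))
        ?_ ?_ (mul_rel.1 hpq) ?_
      · rcases q with q | q <;> exact this
      · intro p q hpq hp
        have hp' : R (lower p) := by rcases p with p | p <;> exact hp
        have hq' := hRt _ _ (stack_low hpq) hp'
        rcases q with q | q <;> exact hq'
      · intro p q hpq hp
        have hp' : Q34 p := by rcases p with p | p <;> exact hp
        have hq' : Q34 q := (h34 q).2 (S.trans ((h34 p).1 hp') (stack_low hpq))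
        rcases q with q | q <;> exact hq'
      · rcases p with p | p <;> exact hp
    have := stack_induction (a := a) (b := b * c)
      (Sum.elim (fun x => R (Sum.inl x)) (Sum.elim (fun x => R (Sum.inr (Sum.inl x))) bot))
      ?_ ?_ (mul_rel.1 h) ?_
    · rcases w with w | w
      · exact (hR (Sum.inl w)).1 this
      · exact this
    · intro p q hpq hp
      have hp' : R (upper p) := by rcases p with p | p <;> exact hp
      have hq' := hRt _ _ (stack_up hpq) hp'
      rcases q with q | q <;> exact hq'
    · intro p q hpq hp
      have hp' : Q24 p := by rcases p with p | p <;> exact hp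
      have hq' := hbc p q hpq hp'
      rcases q with q | q <;> exact hq'
    · rcases z with z | z
      · exact (hR (Sum.inl z)).2 (S.refl _)
      · exact S.refl _

instance : Monoid (PartitionMonoid X) where
  mul_assoc := PartitionMonoid.mul_assoc
  one_mul := PartitionMonoid.one_mul
  mul_one := PartitionMonoid.mul_one

instance [Finite X] : Finite (PartitionMonoid X) :=
  Finite.of_injective (fun a => (fun z w => a.rel z w : X ⊕ X → X ⊕ X → Prop)) fun a b h =>
    PartitionMonoid.ext_rel fun z w => iff_of_eq (congrFun (congrFun h z) w)

end Product

section Brauer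

variable {X : Type*}

/-- The step relation of a walk in the three-row graph that uses edges of the upper and the lower
partition alternately; the flag is `true` after a step in the upper partition. -/
inductive Step (a b : PartitionMonoid X) : (X ⊕ X ⊕ X) × Bool → (X ⊕ X ⊕ X) × Bool → Prop
  | up {z w : X ⊕ X} (h : a.rel z w) (hne : z ≠ w) : Step a b (upper z, false) (upper w, true)
  | low {z w : X ⊕ X} (h : b.rel z w) (hne : z ≠ w) : Step a b (lower z, true) (lower w, false)

/-- Every block has at most two elements. -/
def Thin (a : PartitionMonoid X) : Prop :=
  ∀ z v w, a.rel z v → a.rel z w → z ≠ v → z ≠ w → v = w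

lemma upper_injective : Function.Injective (upper (X := X)) :=
  Function.injective_id.sumMap Sum.inl_injective

lemma lower_injective : Function.Injective (lower (X := X)) := Sum.inr_injective

lemma outer_injective : Function.Injective (outer (X := X)) :=
  Function.injective_id.sumMap Sum.inr_injective

lemma Thin.mul {a b : PartitionMonoid X} (ha : a.Thin) (hb : b.Thin) : (a * b).Thin := by
  intro p q r hq hr hpq hpr
  have hU : Relator.RightUnique (Step a b) := by
    intro s t t' h h'
    obtain ⟨s1, s2⟩ := s
    cases s2 with
    | false =>
      generalize hs : (s1, false) = s at h h'
      cases h with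
      | low => simp at hs
      | up h hne =>
        obtain ⟨rfl, -⟩ := Prod.mk.inj hs
        generalize hs' : (upper _, false) = s at h'
        cases h' with
        | low => simp at hs'
        | up h' hne' =>
          obtain rfl := upper_injective (Prod.mk.inj hs').1
          rw [ha _ _ _ h h' hne hne']
    | true =>
      generalize hs : (s1, true) = s at h h'
      cases h with
      | up => simp at hs
      | low h hne =>
        obtain ⟨rfl, -⟩ := Prod.mk.inj hs
        generalize hs' : (lower _, true) = s at h'
        cases h' with
        | up => simp at hs'
        | low h' hne' =>
          obtain rfl := lower_injective (Prod.mk.inj hs').1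
          rw [hb _ _ _ h h' hne hne']
  -- the walk starts at `p`, with the only possible kind of edge
  let e : X ⊕ X → Bool := Sum.elim (fun _ => false) (fun _ => true)
  let s0 : (X ⊕ X ⊕ X) × Bool := (outer p, e p)
  have hup0 : ∀ z : X ⊕ X, upper z = outer p → e p = false := by
    intro z hz
    rcases p with p | p
    · rfl
    · rcases z with z | z <;> simp [upper, outer] at hz
  have hlow0 : ∀ z : X ⊕ X, lower z = outer p → e p = true := by
    intro z hz
    rcases p with p | p
    · rcases z with z | z <;> simp [lower, outer] at hz
    · rfl
  have reach : ∀ v, stack a b (outer p) v → ∃ t, Relation.ReflTransGen (Step a b) s0 (v, t) := by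
    intro v hv
    refine stack_induction (fun v => ∃ t, Relation.ReflTransGen (Step a b) s0 (v, t))
      ?_ ?_ hv ⟨e p, .refl⟩
    · rintro z w h ⟨t, ht⟩
      by_cases hzw : z = w
      · subst hzw; exact ⟨t, ht⟩
      cases t with
      | false => exact ⟨true, ht.tail (.up h hzw)⟩
      | true =>
        generalize hs : (upper z, true) = s at ht
        cases ht with
        | refl =>
          have h1 := hup0 z (Prod.mk.inj hs).1
          exact absurd ((Prod.mk.inj hs).2.trans h1) (by simp)
        | tail h1 h2 =>
          cases h2 with
          | low => simp at hs
          | @up z' w' h' hne =>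
            obtain rfl := upper_injective (Prod.mk.inj hs).1
            obtain rfl := ha z w z' h (a.rel.symm h') hzw hne.symm
            exact ⟨false, h1⟩
    · rintro z w h ⟨t, ht⟩
      by_cases hzw : z = w
      · subst hzw; exact ⟨t, ht⟩
      cases t with
      | true => exact ⟨false, ht.tail (.low h hzw)⟩
      | false =>
        generalize hs : (lower z, false) = s at ht
        cases ht with
        | refl =>
          have h1 := hlow0 z (Prod.mk.inj hs).1
          exact absurd ((Prod.mk.inj hs).2.trans h1) (by simp)
        | tail h1 h2 =>
          cases h2 with
          | up => simp at hs
          | @low z' w' h' hne =>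
            obtain rfl := lower_injective (Prod.mk.inj hs).1
            obtain rfl := hb z w z' h (b.rel.symm h') hzw hne.symm
            exact ⟨true, h1⟩
  -- a walk that has come back to an outer row cannot be continued
  have stuck : ∀ q t, p ≠ q → Relation.ReflTransGen (Step a b) s0 (outer q, t) →
      ∀ s, ¬ Step a b (outer q, t) s := by
    intro q t hne h s hs
    generalize h1 : (outer q, t) = s1 at h hs
    cases h with
    | refl => exact hne (outer_injective (Prod.mk.inj h1).1).symm
    | tail _ h =>
      cases h with
      | @up _ y _ _ =>
        generalize h2 : (upper _, true) = s2 at h1 hs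
        cases hs with
        | up => simp at h2
        | @low z2 =>
          have h3 := (Prod.mk.inj h1).1
          have h4 := (Prod.mk.inj h2).1
          rcases q with q | q
          · rcases z2 with z2 | z2 <;> simp [outer, lower] at h3
          · rw [← h4] at h3
            rcases y with y | y <;> simp [outer, upper] at h3
      | @low _ y _ _ =>
        generalize h2 : (lower _, false) = s2 at h1 hs
        cases hs with
        | low => simp at h2
        | @up z2 =>
          have h3 := (Prod.mk.inj h1).1
          have h4 := (Prod.mk.inj h2).1
          rcases q with q | q
          · rw [← h4] at h3
            rcases y with y | y <;> simp [outer, lower] at h3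
          · rcases z2 with z2 | z2 <;> simp [outer, upper] at h3
  obtain ⟨t, ht⟩ := reach _ (mul_rel.1 hq)
  obtain ⟨t', ht'⟩ := reach _ (mul_rel.1 hr)
  rcases Relation.ReflTransGen.total_of_right_unique hU ht ht' with h | h
  · rcases h.cases_head with h | ⟨s, h, -⟩
    · exact outer_injective (Prod.mk.inj h).1
    · exact absurd h (stuck q t hpq ht s)
  · rcases h.cases_head with h | ⟨s, h, -⟩
    · exact (outer_injective (Prod.mk.inj h).1).symm
    · exact absurd h (stuck r t' hpr ht' s)

lemma class_mem {a : PartitionMonoid X} (z : X ⊕ X) : {w | a.rel w z} ∈ a.rel.classes :=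
  ⟨z, rfl⟩

lemma thin_iff [Finite X] {a : PartitionMonoid X} :
    (∀ s ∈ a.rel.classes, s.ncard ≤ 2) ↔ a.Thin := by
  constructor
  · intro h z v w hv hw hzv hzw
    by_contra hvw
    have h2 := h _ (class_mem (a := a) z)
    have h3 : 2 < {w | a.rel w z}.ncard := (Set.two_lt_ncard_iff (Set.toFinite _)).2
      ⟨z, v, w, a.rel.refl z, a.rel.symm hv, a.rel.symm hw, hzv, hzw, hvw⟩
    omega
  · rintro h _ ⟨z, rfl⟩
    by_contra h2
    obtain ⟨x, y, w, hx, hy, hw, hxy, hxw, hyw⟩ :=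
      (Set.two_lt_ncard_iff (Set.toFinite _)).1 (not_le.1 h2)
    exact hyw (h x y w (a.rel.trans hx (a.rel.symm hy)) (a.rel.trans hx (a.rel.symm hw)) hxy hxw)

open Classical in
/-- A union of blocks of size two has an even number of elements. -/
lemma even_card_of_saturated [Fintype X] {a : PartitionMonoid X}
    (ha : ∀ s ∈ a.rel.classes, s.ncard = 2) (S : X ⊕ X → Prop)
    (hS : ∀ z w, a.rel z w → S z → S w) : Even (Finset.univ.filter S).card := by
  rw [Finset.card_eq_sum_card_image (Quotient.mk a.rel), Finset.sum_congr rfl (g := fun _ => 2)]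
  · simp
  · intro q hq
    obtain ⟨z, hz, rfl⟩ := Finset.mem_image.1 hq
    rw [← ha _ (class_mem (a := a) z), ← Set.ncard_coe_finset]
    congr 1
    ext w
    simp only [Finset.coe_filter, Finset.mem_filter, Finset.mem_univ, true_and,
      Set.mem_ofPred_eq] at hz ⊢
    exact ⟨fun h => Quotient.exact h.2, fun h => ⟨hS z w (a.rel.symm h) hz, Quotient.sound h⟩⟩

open Classical in
lemma card_filter_sum [Fintype X] (S : X ⊕ X → Prop) : (Finset.univ.filter S).card =
    (Finset.univ.filter fun x => S (Sum.inl x)).card +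
      (Finset.univ.filter fun x => S (Sum.inr x)).card := by
  simp only [Finset.card_filter, Fintype.sum_sum_type]

lemma two_blocks_mul [Finite X] {a b : PartitionMonoid X}
    (ha : ∀ s ∈ a.rel.classes, s.ncard = 2) (hb : ∀ s ∈ b.rel.classes, s.ncard = 2) :
    ∀ s ∈ (a * b).rel.classes, s.ncard = 2 := by
  classical
  have := Fintype.ofFinite X
  have hle : ∀ s ∈ (a * b).rel.classes, s.ncard ≤ 2 :=
    thin_iff.2 ((thin_iff.1 fun s hs => (ha s hs).le).mul (thin_iff.1 fun s hs => (hb s hs).le))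
  rintro _ ⟨z, rfl⟩
  have h2 := hle _ (class_mem z)
  have h1 : 0 < {w | (a * b).rel w z}.ncard :=
    (Set.ncard_pos (Set.toFinite _)).2 ⟨z, (a * b).rel.refl z⟩
  let C : X ⊕ X ⊕ X → Prop := fun v => stack a b v (outer z)
  have e1 := even_card_of_saturated ha (fun p => C (upper p)) fun p q h hp =>
    (stack a b).trans ((stack a b).symm (stack_up h)) hp
  have e2 := even_card_of_saturated hb (fun p => C (lower p)) fun p q h hp =>
    (stack a b).trans ((stack a b).symm (stack_low h)) hp
  have e3 : {w | (a * b).rel w z}.ncard =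
      (Finset.univ.filter fun p => C (outer p)).card := by
    rw [← Set.ncard_coe_finset]
    congr 1
    ext w
    simp [C, mul_rel]
  rw [card_filter_sum] at e1 e2 e3
  change Even ((Finset.univ.filter fun x => C (Sum.inl x)).card +
    (Finset.univ.filter fun x => C (Sum.inr (Sum.inl x))).card) at e1
  change Even ((Finset.univ.filter fun x => C (Sum.inr (Sum.inl x))).card +
    (Finset.univ.filter fun x => C (Sum.inr (Sum.inr x))).card) at e2
  change _ = (Finset.univ.filter fun x => C (Sum.inl x)).card +
    (Finset.univ.filter fun x => C (Sum.inr (Sum.inr x))).card at e3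
  change {w | (a * b).rel w z}.ncard ≤ 2 at h2
  change {w | (a * b).rel w z}.ncard = 2
  rw [Nat.even_iff] at e1 e2
  omega

lemma one_class_ncard [Finite X] : ∀ s ∈ (1 : PartitionMonoid X).rel.classes, s.ncard = 2 := by
  rintro _ ⟨z, rfl⟩
  have : {w | (1 : PartitionMonoid X).rel w z} =
      {Sum.inl (Sum.elim id id z), Sum.inr (Sum.elim id id z)} := by
    ext w
    rcases w with w | w <;> simp
  rw [this]
  exact Set.ncard_pair (by simp)

variable (X) in
/-- The partial Brauer monoid: all blocks have size at most two. -/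
def partialBrauer [Finite X] : Submonoid (PartitionMonoid X) where
  carrier := {a | ∀ s ∈ a.rel.classes, s.ncard ≤ 2}
  one_mem' := fun s hs => (one_class_ncard s hs).le
  mul_mem' := fun ha hb => thin_iff.2 ((thin_iff.1 ha).mul (thin_iff.1 hb))

variable (X) in
/-- The Brauer monoid: all blocks have size exactly two. -/
def brauer [Finite X] : Submonoid (PartitionMonoid X) where
  carrier := {a | ∀ s ∈ a.rel.classes, s.ncard = 2}
  one_mem' := one_class_ncard
  mul_mem' := two_blocks_mul

end Brauer

end PartitionMonoid

section Conjugacy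

variable {M : Type*} [Monoid M]

/-- The conjugacy `∼_o` in a monoid: `a g = g b` and `b h = h a` for some `g`, `h`. -/
def OConj (a b : M) : Prop := ∃ g h : M, a * g = g * b ∧ b * h = h * a

/-- `u` and `v` are mutually inverse elements of a subgroup of `M` with identity element `e`. -/
def IsGroupInverse (e u v : M) : Prop :=
  e * e = e ∧ e * u = u ∧ u * e = u ∧ e * v = v ∧ v * e = v ∧ u * v = e ∧ v * u = e

/-- `u` lies in a subgroup of (the multiplicative semigroup of) `M`. -/
def IsGroupElement (u : M) : Prop := ∃ e v, IsGroupInverse e u v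

lemma exists_idempotent_pow [Finite M] (a : M) : ∃ k, 0 < k ∧ IsIdempotentElem (a ^ k) := by
  obtain ⟨i, j, hij, h⟩ : ∃ i j, i < j ∧ a ^ i = a ^ j := by
    obtain ⟨i, j, hne, h⟩ := Finite.exists_ne_map_eq_of_infinite fun n : ℕ => a ^ n
    rcases hne.lt_or_gt with h' | h'
    exacts [⟨i, j, h', h⟩, ⟨j, i, h', h.symm⟩]
  obtain ⟨d, hd, rfl⟩ : ∃ d, 0 < d ∧ j = i + d := ⟨j - i, by omega, by omega⟩
  have h1 : ∀ t, a ^ i = a ^ (i + t * d) := by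
    intro t
    induction t with
    | zero => simp
    | succ t ih =>
      rw [show i + (t + 1) * d = (i + t * d) + d by ring, pow_add, ← ih, ← pow_add]
      exact h
  have hk : i ≤ (i + 1) * d := by nlinarith
  refine ⟨(i + 1) * d, by positivity, ?_⟩
  obtain ⟨c, hc⟩ := Nat.exists_eq_add_of_le hk
  change a ^ _ * a ^ _ = a ^ _
  rw [← pow_add]
  conv_rhs => rw [hc, pow_add, h1 (i + 1), ← pow_add]
  congr 1
  omega

open Classical in
/-- `a^ω`, the idempotent power of `a` (with positive exponent) in a finite monoid. -/
noncomputable def omegaPow [Finite M] (a : M) : M := a ^ Nat.find (exists_idempotent_pow a)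

/-- `a^{ω+1} = a^ω a`. -/
noncomputable def omegaSucc [Finite M] (a : M) : M := omegaPow a * a

open Classical in
lemma isGroupElement_omegaSucc [Finite M] (a : M) : IsGroupElement (omegaSucc a) := by
  obtain ⟨h0, h⟩ := Nat.find_spec (exists_idempotent_pow a)
  have he : omegaPow a = a ^ Nat.find (exists_idempotent_pow a) := rfl
  generalize Nat.find (exists_idempotent_pow a) = k at *
  obtain ⟨k, rfl⟩ : ∃ j, k = j + 1 := ⟨k - 1, by omega⟩
  have hc : ∀ m, omegaPow a * a ^ m = a ^ m * omegaPow a := by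
    intro m
    rw [he, ← pow_add, ← pow_add, add_comm]
  have hi : omegaPow a * omegaPow a = omegaPow a := by rw [he]; exact h
  have hi' : ∀ x, omegaPow a * (omegaPow a * x) = omegaPow a * x := by
    intro x; rw [← mul_assoc, hi]
  have hc1 : a * omegaPow a = omegaPow a * a := by simpa using (hc 1).symm
  have hs : a * a ^ k = omegaPow a := by rw [he, pow_succ']
  have hs' : a ^ k * a = omegaPow a := by rw [he, pow_succ]
  refine ⟨omegaPow a, omegaPow a * a ^ k, hi, hi' _, ?_, hi' _, ?_, ?_, ?_⟩
  · rw [omegaSucc, mul_assoc, hc1, hi']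
  · rw [mul_assoc, ← hc, hi']
  · rw [omegaSucc, mul_assoc, ← mul_assoc a, hc1, mul_assoc, hs, hi, hi]
  · rw [omegaSucc, mul_assoc, ← mul_assoc (a ^ k), ← hc, mul_assoc, hs', hi, hi]

end Conjugacy

namespace PartitionMonoid

section CycleType

variable {X : Type*}

/-- The equivalence relation `ker(a) ∨ coker^∧(a)` on `X`. -/
def kerJoin (a : PartitionMonoid X) : Setoid X :=
  a.rel.comap Sum.inl ⊔ a.rel.comap Sum.inr

/-- The set of the blocks `P` of `ker(a) ∨ coker^∧(a)` that intersect a transversal block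
of `a`. -/
def TransversalClass (a : PartitionMonoid X) : Type _ :=
  {P : Quotient a.kerJoin // ∃ x y, a.rel (Sum.inl x) (Sum.inr y) ∧ Quotient.mk a.kerJoin x = P}

instance [Finite X] (a : PartitionMonoid X) : Finite a.TransversalClass :=
  inferInstanceAs (Finite {P : Quotient a.kerJoin // _})

/-- `a` has a transversal block `A ∪ B'` with `A ⊆ P` and `B ⊆ Q`. -/
def Linked (a : PartitionMonoid X) (P Q : a.TransversalClass) : Prop :=
  ∃ x y, a.rel (Sum.inl x) (Sum.inr y) ∧
    Quotient.mk a.kerJoin x = P.1 ∧ Quotient.mk a.kerJoin y = Q.1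

lemma kerJoin_induction {a : PartitionMonoid X} (Q : X → Prop)
    (hu : ∀ x y, a.rel (Sum.inl x) (Sum.inl y) → Q x → Q y)
    (hl : ∀ x y, a.rel (Sum.inr x) (Sum.inr y) → Q x → Q y)
    {x y : X} (h : a.kerJoin x y) (hx : Q x) : Q y := by
  let s : Setoid X := ⟨fun x y => Q x ↔ Q y, fun _ => Iff.rfl, Iff.symm, Iff.trans⟩
  have : a.kerJoin ≤ s := sup_le
    (fun {x y} h => ⟨hu x y h, hu y x (a.rel.symm h)⟩)
    (fun {x y} h => ⟨hl x y h, hl y x (a.rel.symm h)⟩)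
  exact (this h).1 hx

lemma ker_mul {a b : PartitionMonoid X} {x y : X} (h : a.rel (Sum.inl x) (Sum.inl y)) :
    (a * b).rel (Sum.inl x) (Sum.inl y) :=
  mul_rel.2 (stack_up (a := a) (b := b) h)

lemma coker_mul {a b : PartitionMonoid X} {x y : X} (h : b.rel (Sum.inr x) (Sum.inr y)) :
    (a * b).rel (Sum.inr x) (Sum.inr y) :=
  mul_rel.2 (stack_low (a := a) (b := b) h)

lemma dom_of_mul {a b : PartitionMonoid X} {x y : X} (h : (a * b).rel (Sum.inl x) (Sum.inr y)) :
    ∃ z, a.rel (Sum.inl x) (Sum.inr z) := by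
  by_contra hn
  push Not at hn
  refine stack_induction (a := a) (b := b)
    (Sum.elim (fun w => a.rel (Sum.inl x) (Sum.inl w)) fun _ => False) ?_ ?_ (mul_rel.1 h) ?_
  · rintro (p | p) (q | q) hpq hp
    · exact a.rel.trans hp hpq
    · exact hn q (a.rel.trans hp hpq)
    · exact False.elim hp
    · exact False.elim hp
  · intro p q _ hp
    exact hp
  · exact a.rel.refl _

lemma _root_.IsGroupInverse.ker_iff {e u v : PartitionMonoid X} (h : IsGroupInverse e u v) {x y : X} :
    u.rel (Sum.inl x) (Sum.inl y) ↔ e.rel (Sum.inl x) (Sum.inl y) := by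
  obtain ⟨-, eu, -, -, -, uv, -⟩ := h
  exact ⟨fun h => uv ▸ ker_mul (b := v) h, fun h => eu ▸ ker_mul (b := u) h⟩

lemma _root_.IsGroupInverse.coker_iff {e u v : PartitionMonoid X} (h : IsGroupInverse e u v) {x y : X} :
    u.rel (Sum.inr x) (Sum.inr y) ↔ e.rel (Sum.inr x) (Sum.inr y) := by
  obtain ⟨-, -, ue, -, -, -, vu⟩ := h
  exact ⟨fun h => vu ▸ coker_mul (a := v) h, fun h => ue ▸ coker_mul (a := u) h⟩

lemma _root_.IsGroupInverse.upper_unique {e u v : PartitionMonoid X} (h : IsGroupInverse e u v)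
    {x y x' y' : X} (h1 : u.rel (Sum.inl x) (Sum.inr y)) (h2 : u.rel (Sum.inl x') (Sum.inr y'))
    (hy : u.kerJoin y y') : u.rel (Sum.inl x) (Sum.inl x') := by
  have mid : stack u e (Sum.inr (Sum.inl y)) (Sum.inr (Sum.inl y')) := by
    refine kerJoin_induction (fun w => stack u e (Sum.inr (Sum.inl y)) (Sum.inr (Sum.inl w)))
      ?_ ?_ hy ((stack u e).refl _)
    · intro p q hpq hp
      exact (stack u e).trans hp (stack_low (a := u) (b := e) (h.ker_iff.1 hpq))
    · intro p q hpq hp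
      exact (stack u e).trans hp (stack_up (a := u) (b := e) hpq)
  have key : (u * e).rel (Sum.inl x) (Sum.inl x') :=
    mul_rel.2 ((stack u e).trans (stack_up (a := u) (b := e) h1)
      ((stack u e).trans mid ((stack u e).symm (stack_up (a := u) (b := e) h2))))
  rwa [h.2.2.1] at key

lemma _root_.IsGroupInverse.lower_unique {e u v : PartitionMonoid X} (h : IsGroupInverse e u v)
    {x y x' y' : X} (h1 : u.rel (Sum.inl x) (Sum.inr y)) (h2 : u.rel (Sum.inl x') (Sum.inr y'))
    (hx : u.kerJoin x x') : u.rel (Sum.inr y) (Sum.inr y') := by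
  have mid : stack e u (Sum.inr (Sum.inl x)) (Sum.inr (Sum.inl x')) := by
    refine kerJoin_induction (fun w => stack e u (Sum.inr (Sum.inl x)) (Sum.inr (Sum.inl w)))
      ?_ ?_ hx ((stack e u).refl _)
    · intro p q hpq hp
      exact (stack e u).trans hp (stack_low (a := e) (b := u) hpq)
    · intro p q hpq hp
      exact (stack e u).trans hp (stack_up (a := e) (b := u) (h.coker_iff.1 hpq))
  have key : (e * u).rel (Sum.inr y) (Sum.inr y') :=
    mul_rel.2 ((stack e u).trans ((stack e u).symm (stack_low (a := e) (b := u) h1))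
      ((stack e u).trans mid (stack_low (a := e) (b := u) h2)))
  rwa [h.2.1] at key

lemma _root_.IsGroupInverse.exists_next {e u v : PartitionMonoid X} (h : IsGroupInverse e u v)
    {x y : X} (h1 : u.rel (Sum.inl x) (Sum.inr y)) :
    ∃ z w, u.kerJoin y z ∧ u.rel (Sum.inl z) (Sum.inr w) := by
  by_contra hn
  push Not at hn
  have hne : ∀ z w, u.kerJoin y z → ¬ e.rel (Sum.inl z) (Sum.inr w) := by
    intro z w hz hw
    have : (u * v).rel (Sum.inl z) (Sum.inr w) := by rwa [h.2.2.2.2.2.1]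
    obtain ⟨t, ht⟩ := dom_of_mul this
    exact hn z t hz ht
  have hk : ∀ p q, u.rel (Sum.inl p) (Sum.inl q) → u.kerJoin p q := fun p q h =>
    (le_sup_left : _ ≤ u.kerJoin) h
  have hc : ∀ p q, u.rel (Sum.inr p) (Sum.inr q) → u.kerJoin p q := fun p q h =>
    (le_sup_right : _ ≤ u.kerJoin) h
  have hue : (u * e).rel (Sum.inl x) (Sum.inr y) := by rwa [h.2.2.1]
  refine stack_induction (a := u) (b := e)
    (Sum.elim (fun w => u.rel (Sum.inl x) (Sum.inl w))
      (Sum.elim (fun w => u.kerJoin y w) fun _ => False)) ?_ ?_ (mul_rel.1 hue) (u.rel.refl _)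
  · rintro (p | p) (q | q) hpq hp
    · exact u.rel.trans hp hpq
    · exact hc y q (u.rel.trans (u.rel.symm h1) (u.rel.trans hp hpq))
    · exact h.upper_unique h1 (u.rel.symm hpq) hp
    · exact u.kerJoin.trans hp (hc p q hpq)
  · rintro (p | p) (q | q) hpq hp
    · exact u.kerJoin.trans hp (hk p q (h.ker_iff.2 hpq))
    · exact hne p q hp hpq
    · exact hp.elim
    · exact hp.elim

lemma linked_existsUnique {u : PartitionMonoid X} (hu : IsGroupElement u)
    (P : u.TransversalClass) : ∃! Q, u.Linked P Q := by
  obtain ⟨e, v, h⟩ := hu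
  obtain ⟨P, x, y, hxy, hx⟩ := P
  obtain ⟨z, w, hz, hw⟩ := h.exists_next hxy
  refine ⟨⟨Quotient.mk _ y, z, w, hw, Quotient.sound (u.kerJoin.symm hz)⟩, ⟨x, y, hxy, hx, rfl⟩, ?_⟩
  rintro ⟨Q, hQ⟩ ⟨x', y', hxy', hx', hy'⟩
  refine Subtype.ext (hy'.symm.trans (Quotient.sound ?_))
  exact (le_sup_right : _ ≤ u.kerJoin)
    (h.lower_unique hxy' hxy (Quotient.exact (hx'.trans hx.symm)))

lemma linked_injective {u : PartitionMonoid X} (hu : IsGroupElement u)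
    {P P' Q : u.TransversalClass} (h1 : u.Linked P Q) (h2 : u.Linked P' Q) : P = P' := by
  obtain ⟨e, v, h⟩ := hu
  obtain ⟨x, y, hxy, hx, hy⟩ := h1
  obtain ⟨x', y', hxy', hx', hy'⟩ := h2
  refine Subtype.ext (hx.symm.trans (Eq.trans (Quotient.sound ?_) hx'))
  exact (le_sup_left : _ ≤ u.kerJoin)
    (h.upper_unique hxy hxy' (Quotient.exact (hy.trans hy'.symm)))

/-- The permutation `τ_u` of a group element `u`: it maps `P` to the unique `Q` such that `u` has a
transversal block `A ∪ B'` with `A ⊆ P` and `B ⊆ Q`. -/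
noncomputable def tau [Finite X] (u : PartitionMonoid X) (hu : IsGroupElement u) :
    Equiv.Perm u.TransversalClass :=
  Equiv.ofBijective (fun P => (linked_existsUnique hu P).choose)
    (Finite.injective_iff_bijective.1 fun P P' hP =>
      linked_injective hu (linked_existsUnique hu P).choose_spec.1
        (by
          have := (linked_existsUnique hu P').choose_spec.1
          simp only at hP
          rwa [← hP] at this))

lemma tau_eq_iff [Finite X] {u : PartitionMonoid X} (hu : IsGroupElement u)
    (P Q : u.TransversalClass) : u.tau hu P = Q ↔ u.Linked P Q :=
  ⟨fun h => h ▸ (linked_existsUnique hu P).choose_spec.1, fun h =>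
    ((linked_existsUnique hu P).choose_spec.2 Q h).symm⟩

open Classical in
/-- The `i`-th entry of the cycle type of a group element `u`: the number of cycles of length `i`
of `τ_u`, where fixed points count as cycles of length one. -/
noncomputable def cycleCount [Finite X] (u : PartitionMonoid X) (hu : IsGroupElement u)
    (i : ℕ) : ℕ :=
  letI := Fintype.ofFinite u.TransversalClass
  (u.tau hu).partition.parts.count i

end CycleType

end PartitionMonoid

/-! ### Intertwiners built from absorbing elements. -/

section Absorption

variable {M : Type*} [Monoid M]

/-! In `P_n` and `PB_n` the partition into singletons, `discrete`, is available. The partitions `a ^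
k * discrete` only become coarser as `k` grows, so by finiteness some `z₁ = a ^ k * discrete`
satisfies `a * z₁ = z₁`; on the other side some `discrete * b ^ l` is fixed by `b`. Then `g = a ^ k
* discrete * b ^ l` absorbs both: `a * g = g = g * b`.

In the Brauer monoid, compressing an intertwiner `g` to `a^ω g b^ω` reduces the question to the
group elements `u = a^{ω+1}` and `v = b^{ω+1}`, and the compressed `g` contains the upper blocks of
`u` and the lower blocks of `v`. What remains of `g` is a perfect matching `m` of the domain points
of the transversals of `u` together with the codomain points of the transversals of `v`. Each class
in the permutations `σ = τ_u` and `τ = τ_v` has exactly one such point, so `m` is a fixed-point-free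
involution of the disjoint union of the classes (`exists_matching`, `exists_compatible`).
Multiplication by `u` on the left and by `v` on the right moves `m` by `σ` and by `τ`
(`Compatible.mul_left`, `Compatible.mul_right`), whence `u * g = g * v` exactly when `m` commutes
with `σ ⊕ τ` (`Compatible.mul_eq_mul_iff`).

A permutation commutes with a fixed-point-free involution if and only if it has evenly many cycles
of each odd length: cycles of equal odd length are paired, and a cycle of even length may be rotated
by half a turn (`exists_commuting_involution_iff`). For `σ ⊕ τ` the number of `i`-cycles is `k_i +
l_i`, which gives the parity condition. The condition is symmetric, so the second conjugator comes
for free. -/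

/-- If `a ^ k * z` and `z * b ^ l` are fixed by `a` and `b`, they give a solution of `a g = g b`. -/
lemma exists_intertwiner_of_fixed {a b z : M} {k l : ℕ} (ha : a * (a ^ k * z) = a ^ k * z)
    (hb : z * b ^ l * b = z * b ^ l) : ∃ g, a * g = g * b :=
  ⟨a ^ k * z * b ^ l, calc
    a * (a ^ k * z * b ^ l) = a * (a ^ k * z) * b ^ l := by rw [mul_assoc a]
    _ = a ^ k * (z * b ^ l * b) := by rw [ha, hb, mul_assoc]
    _ = a ^ k * z * b ^ l * b := by simp only [mul_assoc]⟩

end Absorption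

/-! ### The refinement order, and the partition and partial Brauer monoids. -/

namespace PartitionMonoid

section Order

variable {X : Type*}

lemma stack_mono {a a' b b' : PartitionMonoid X} (ha : a.rel ≤ a'.rel) (hb : b.rel ≤ b'.rel) :
    stack a b ≤ stack a' b' := by
  intro v w h
  refine stack_induction (fun t => stack a' b' v t) ?_ ?_ h ((stack a' b').refl v)
  · exact fun _ _ h hv => (stack a' b').trans hv (stack_up (ha h))
  · exact fun _ _ h hv => (stack a' b').trans hv (stack_low (hb h))

lemma mul_rel_mono {a a' b b' : PartitionMonoid X} (ha : a.rel ≤ a'.rel) (hb : b.rel ≤ b'.rel) :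
    (a * b).rel ≤ (a' * b').rel :=
  fun _ _ h => stack_mono ha hb h

/-- The partition into singletons. -/
def discrete : PartitionMonoid X := ⟨⊥⟩

/-- A sequence of partitions that becomes coarser and coarser is stationary somewhere. -/
lemma exists_eq_succ_of_monotone [Finite X] (f : ℕ → PartitionMonoid X)
    (hf : ∀ k, (f k).rel ≤ (f (k + 1)).rel) : ∃ k, f (k + 1) = f k := by
  have hm : Monotone fun k => (f k).rel := monotone_nat_of_le_succ hf
  obtain ⟨i, j, hne, h⟩ := Finite.exists_ne_map_eq_of_infinite f
  wlog hij : i < j generalizing i j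
  · exact this j i hne.symm h.symm (by omega)
  refine ⟨i, PartitionMonoid.ext (le_antisymm ?_ (hf i))⟩
  -- With `f i = f j` and `i + 1 ≤ j`, the term `f (i + 1)` is squeezed between two equal ones.
  rw [h]
  exact hm hij

/-- `discrete` lies below `a * discrete`, and products are monotone, so `a ^ k * discrete` is a
coarsening sequence; where it stops moving, `a` fixes it. -/
lemma exists_left_fixed [Finite X] (a : PartitionMonoid X) :
    ∃ k, a * (a ^ k * discrete) = a ^ k * discrete := by
  obtain ⟨k, hk⟩ := exists_eq_succ_of_monotone (fun k => a ^ k * discrete) fun k => by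
    rw [pow_succ, mul_assoc]
    exact mul_rel_mono le_rfl bot_le
  exact ⟨k, by rwa [← mul_assoc, ← pow_succ']⟩

lemma exists_right_fixed [Finite X] (b : PartitionMonoid X) :
    ∃ k, discrete * b ^ k * b = discrete * b ^ k := by
  obtain ⟨k, hk⟩ := exists_eq_succ_of_monotone (fun k => discrete * b ^ k) fun k => by
    rw [pow_succ', ← mul_assoc]
    exact mul_rel_mono bot_le le_rfl
  exact ⟨k, by rwa [mul_assoc, ← pow_succ]⟩

lemma discrete_mem_partialBrauer [Finite X] : (discrete : PartitionMonoid X) ∈ partialBrauer X :=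
  thin_iff.2 fun _ _ _ hv _ hzv => absurd hv hzv

theorem oConj_partition [Finite X] (a b : PartitionMonoid X) : OConj a b := by
  have key : ∀ a b : PartitionMonoid X, ∃ g, a * g = g * b := fun a b =>
    exists_intertwiner_of_fixed (exists_left_fixed a).choose_spec (exists_right_fixed b).choose_spec
  obtain ⟨g, hg⟩ := key a b
  obtain ⟨h, hh⟩ := key b a
  exact ⟨g, h, hg, hh⟩

/-- The conjugators are products of powers of `a` and `b` with `discrete`, whose blocks are small
enough for the partial Brauer monoid. For nonempty `X` they are too small for the Brauer monoid,
which is where this argument stops. -/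
theorem oConj_partialBrauer [Finite X] (a b : partialBrauer X) : OConj a b := by
  have key : ∀ a b : partialBrauer X, ∃ g, a * g = g * b := by
    intro a b
    obtain ⟨k, hk⟩ := exists_left_fixed (a : PartitionMonoid X)
    obtain ⟨l, hl⟩ := exists_right_fixed (b : PartitionMonoid X)
    exact exists_intertwiner_of_fixed (z := (⟨discrete, discrete_mem_partialBrauer⟩ :
      partialBrauer X)) (Subtype.ext hk) (Subtype.ext hl)
  obtain ⟨g, hg⟩ := key a b
  obtain ⟨h, hh⟩ := key b a
  exact ⟨g, h, hg, hh⟩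

end Order

end PartitionMonoid

/-! ### Cycle counts expressed through minimal periods. -/

namespace Equiv.Perm

open Function

section Count

variable {Z : Type*} [Fintype Z] [DecidableEq Z]

lemma minimalPeriod_eq_card_support_cycleOf (ρ : Perm Z) {z : Z} (hz : ρ z ≠ z) :
    minimalPeriod ρ z = (ρ.cycleOf z).support.card := by
  -- Two natural numbers with the same multiples are equal; here the multiples are the exponents `n`
  -- for which `ρ ^ n` fixes `z`.
  refine Nat.dvd_right_iff_eq.1 fun n => ?_
  rw [← isPeriodicPt_iff_minimalPeriod_dvd,
    ← (isCycleOn_support_cycleOf ρ z).pow_apply_eq (mem_support_cycleOf_iff.2 ⟨.rfl, mem_support.2 hz⟩),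
    ← iterate_eq_pow]
  rfl

/-- The points on the cycles of length `i` of a permutation. -/
lemma card_minimalPeriod_eq (ρ : Perm Z) (i : ℕ) :
    (Finset.univ.filter fun z => minimalPeriod ρ z = i).card = i * ρ.partition.parts.count i := by
  rw [parts_partition, Multiset.count_add, Multiset.count_replicate]
  -- `cycleType` omits fixed points, which enter `partition` as separate parts equal to one, so
  -- length one is counted by the complement of the support.
  by_cases h1 : i = 1
  · subst h1
    have h0 : Multiset.count 1 ρ.cycleType = 0 :=
      Multiset.count_eq_zero.2 fun h => absurd (two_le_of_mem_cycleType h) (by norm_num)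
    rw [h0, if_pos rfl, zero_add, one_mul, ← Finset.card_compl]
    congr 1
    ext z
    simp [minimalPeriod_eq_one_iff_isFixedPt, IsFixedPt]
  rw [if_neg (Ne.symm h1), add_zero, cycleType_def, Multiset.count_map]
  have hmoved : ∀ z, minimalPeriod ρ z = i → ρ z ≠ z := fun z hz h =>
    h1 (hz ▸ minimalPeriod_eq_one_iff_isFixedPt.2 h)
  change _ = i * (ρ.cycleFactorsFinset.filter fun c => i = c.support.card).card
  rw [mul_comm, Finset.card_eq_sum_card_fiberwise (f := ρ.cycleOf)
    (t := ρ.cycleFactorsFinset.filter fun c => i = c.support.card)]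
  · refine Finset.sum_const_nat fun c hc => ?_
    obtain ⟨hc, hi⟩ := Finset.mem_filter.1 hc
    rw [hi]
    congr 1
    ext z
    simp only [Finset.mem_filter, Finset.mem_univ, true_and]
    constructor
    · rintro ⟨hz, rfl⟩
      exact mem_support_cycleOf_iff.2 ⟨.rfl, mem_support.2 (hmoved z (hz.trans hi.symm))⟩
    · intro hz
      have hcz : ρ.cycleOf z = c := ((cycle_is_cycleOf hz hc)).symm
      refine ⟨?_, hcz⟩
      rw [minimalPeriod_eq_card_support_cycleOf, hcz]
      exact mem_support.1 (mem_cycleFactorsFinset_support_le hc hz)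
  · intro z hz
    have hz : minimalPeriod ρ z = i := by simpa using hz
    simp only [Finset.coe_filter, Set.mem_ofPred_eq]
    refine ⟨cycleOf_mem_cycleFactorsFinset_iff.2 (mem_support.2 (hmoved z hz)), ?_⟩
    rw [← minimalPeriod_eq_card_support_cycleOf ρ (hmoved z hz), hz]

end Count

end Equiv.Perm

/-! ### Parity and fixed-point-free involutions of finite sets. -/

/-- A fixed-point-free involution on a finite set forces an even number of elements. -/
lemma Finset.even_card_of_involution {Z : Type*} (s : Finset Z) (m : Z → Z)
    (hs : ∀ z ∈ s, m z ∈ s) (hm : ∀ z ∈ s, m (m z) = z) (hne : ∀ z ∈ s, m z ≠ z) :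
    Even s.card := by
  -- The cardinality modulo two is a sum of ones, which cancel in pairs under `m`.
  have h : ∑ _z ∈ s, (1 : ZMod 2) = 0 :=
    Finset.sum_involution (fun z _ => m z) (fun _ _ => by decide) (fun z hz _ => hne z hz)
      hs hm
  rw [← ZMod.natCast_eq_zero_iff_even]
  simpa using h

/-- A finite set with an even number of elements carries a fixed-point-free involution. -/
lemma exists_involutive_of_even_card {O : Type*} [Fintype O] (h : Even (Fintype.card O)) :
    ∃ κ : O → O, Function.Involutive κ ∧ ∀ o, κ o ≠ o := by
  obtain ⟨k, hk⟩ := h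
  let e : O ≃ Fin k × Bool := Fintype.equivOfCardEq (by simp [hk, mul_two])
  refine ⟨fun o => e.symm ((e o).1, !(e o).2), fun o => by simp, fun o h => ?_⟩
  have := congrArg (fun o => (e o).2) h
  simp at this

/-- If all odd fibres of `f` have even size, there is an involution that preserves `f` and has no
fixed points in odd fibres. -/
lemma exists_involutive_of_even_fibers {O : Type*} [Fintype O] (f : O → ℕ)
    (h : ∀ i, Odd i → Even (Finset.univ.filter fun o => f o = i).card) :
    ∃ κ : O → O, Function.Involutive κ ∧ (∀ o, f (κ o) = f o) ∧ ∀ o, Odd (f o) → κ o ≠ o := by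
  have hfib : ∀ i, ∃ κ : {o // f o = i} → {o // f o = i}, Function.Involutive κ ∧
      (Odd i → ∀ o, κ o ≠ o) := by
    intro i
    by_cases hi : Odd i
    · obtain ⟨κ, h1, h2⟩ := exists_involutive_of_even_card (O := {o // f o = i})
        (by rw [Fintype.card_subtype]; exact h i hi)
      exact ⟨κ, h1, fun _ => h2⟩
    · exact ⟨id, fun _ => rfl, fun h => absurd h hi⟩
  choose κ h1 h2 using hfib
  -- The fibre type depends on its index; this moves `κ` between indices that are equal only
  -- propositionally.
  have key : ∀ i o (ho : f o = i), (κ (f o) ⟨o, rfl⟩).1 = (κ i ⟨o, ho⟩).1 := by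
    rintro i o rfl
    rfl
  refine ⟨fun o => (κ (f o) ⟨o, rfl⟩).1, fun o => ?_, fun o => (κ (f o) ⟨o, rfl⟩).2,
    fun o ho h => h2 _ ho ⟨o, rfl⟩ (Subtype.ext h)⟩
  change (κ (f (κ (f o) ⟨o, rfl⟩).1) ⟨(κ (f o) ⟨o, rfl⟩).1, rfl⟩).1 = o
  rw [key (f o) _ (κ (f o) ⟨o, rfl⟩).2]
  exact congrArg Subtype.val (h1 (f o) ⟨o, rfl⟩)

/-! ### Involutions commuting with a permutation. -/

namespace Equiv.Perm

open Function

section Zpow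

variable {Z : Type*} (ρ : Perm Z)

lemma zpow_apply_eq_self_iff_minimalPeriod_dvd (x : Z) (n : ℤ) :
    (ρ ^ n) x = x ↔ (minimalPeriod ρ x : ℤ) ∣ n :=
  MulAction.zpow_smul_eq_iff_minimalPeriod_dvd (a := ρ) (b := x)

lemma zpow_apply_eq_zpow_apply_iff (x : Z) (n k : ℤ) :
    (ρ ^ n) x = (ρ ^ k) x ↔ (minimalPeriod ρ x : ℤ) ∣ n - k := by
  rw [← zpow_apply_eq_self_iff_minimalPeriod_dvd, sub_eq_neg_add, zpow_add, mul_apply, zpow_neg,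
    inv_eq_iff_eq]

lemma minimalPeriod_zpow_apply (x : Z) (n : ℤ) :
    minimalPeriod ρ ((ρ ^ n) x) = minimalPeriod ρ x := by
  refine Nat.dvd_right_iff_eq.1 fun k => ?_
  rw [← Int.natCast_dvd_natCast, ← Int.natCast_dvd_natCast,
    ← zpow_apply_eq_self_iff_minimalPeriod_dvd, ← zpow_apply_eq_self_iff_minimalPeriod_dvd,
    ← mul_apply, ← zpow_add, add_comm, zpow_add, mul_apply, EmbeddingLike.apply_eq_iff_eq]

end Zpow

section Involution

variable {Z : Type*} [Fintype Z] (ρ : Perm Z)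

lemma minimalPeriod_pos (z : Z) : 0 < minimalPeriod ρ z :=
  IsPeriodicPt.minimalPeriod_pos (orderOf_pos ρ) (by
    rw [IsPeriodicPt, IsFixedPt, iterate_eq_pow, pow_orderOf_eq_one, one_apply])

-- The first `i` iterates of a representative run once through its cycle. For odd `i` this turns the
-- parity of the number of points into the parity of the number of cycles, as needed for pairing
-- cycles.
open Classical in
lemma card_minimalPeriod_eq_mul_card_orbits (i : ℕ) :
    (Finset.univ.filter fun z => minimalPeriod ρ z = i).card =
      i * (Finset.univ.filter fun o : Quotient (SameCycle.setoid ρ) =>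
        minimalPeriod ρ o.out = i).card := by
  have hout : ∀ z, ∃ n : ℤ, (ρ ^ n) (Quotient.mk (SameCycle.setoid ρ) z).out = z := fun z =>
    Quotient.mk_out (s := SameCycle.setoid ρ) z
  rw [mul_comm, Finset.card_eq_sum_card_fiberwise (f := Quotient.mk (SameCycle.setoid ρ))
    (t := Finset.univ.filter fun o : Quotient (SameCycle.setoid ρ) => minimalPeriod ρ o.out = i)]
  · refine Finset.sum_const_nat fun o ho => ?_
    have ho : minimalPeriod ρ o.out = i := by simpa using ho
    have himg : (Finset.univ.filter fun z => minimalPeriod ρ z = i).filter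
        (fun z => Quotient.mk (SameCycle.setoid ρ) z = o) =
        (Finset.range i).image fun n => ρ^[n] o.out := by
      ext z
      simp only [Finset.mem_filter, Finset.mem_univ, true_and, Finset.mem_image, Finset.mem_range]
      constructor
      · rintro ⟨hz, rfl⟩
        obtain ⟨n, hn⟩ := hout z
        have hi : (0 : ℤ) < i := by rw [← hz]; exact_mod_cast ρ.minimalPeriod_pos z
        -- An integer exponent reaching `z` is reduced modulo the period into `range i`.
        refine ⟨(n % i).toNat, by have := Int.emod_lt_of_pos n hi; omega, ?_⟩
        conv_rhs => rw [← hn]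
        rw [iterate_eq_pow, ← zpow_natCast, Int.toNat_of_nonneg (Int.emod_nonneg _ hi.ne'),
          zpow_apply_eq_zpow_apply_iff, ho]
        exact ⟨-(n / i), by have := Int.emod_add_mul_ediv n i; linarith⟩
      · rintro ⟨n, -, rfl⟩
        rw [iterate_eq_pow, ← zpow_natCast, minimalPeriod_zpow_apply]
        refine ⟨ho, ?_⟩
        conv_rhs => rw [← Quotient.out_eq o]
        exact Quotient.sound (s := SameCycle.setoid ρ) (SameCycle.symm ⟨n, rfl⟩)
    rw [himg, Finset.card_image_of_injOn, Finset.card_range]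
    intro n hn k hk h
    rw [Finset.coe_range, ← ho] at hn hk
    exact iterate_injOn_Iio_minimalPeriod hn hk h
  · intro z hz
    have hz : minimalPeriod ρ z = i := by simpa using hz
    obtain ⟨n, hn⟩ := hout z
    have := ρ.minimalPeriod_zpow_apply (Quotient.mk (SameCycle.setoid ρ) z).out n
    rw [hn] at this
    simp [← this, hz]

-- Cycles of odd length are matched with other cycles of the same length, and each cycle of even
-- length is rotated by half its length. It is enough to prescribe the image of one representative
-- per cycle and extend equivariantly.
open Classical in
lemma exists_commuting_involution
    (h : ∀ i, Odd i → Even (Finset.univ.filter fun z => minimalPeriod ρ z = i).card) :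
    ∃ m : Z → Z, Involutive m ∧ (∀ z, m z ≠ z) ∧ ∀ z, m (ρ z) = ρ (m z) := by
  let O := Quotient (SameCycle.setoid ρ)
  obtain ⟨κ, hκ, hκp, hκne⟩ := exists_involutive_of_even_fibers
    (fun o : O => minimalPeriod ρ o.out) fun i hi => by
      have := h i hi
      rw [card_minimalPeriod_eq_mul_card_orbits, Nat.even_mul] at this
      exact this.resolve_left (Nat.not_even_iff_odd.2 hi)
  -- `w o` is the intended image of the representative of `o`: the representative of the partner
  -- cycle, or the antipodal point of the same cycle.
  let w : O → Z := fun o => if Odd (minimalPeriod ρ o.out) then (κ o).out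
    else (ρ ^ ((minimalPeriod ρ o.out / 2 : ℕ) : ℤ)) o.out
  have hw : ∀ o, minimalPeriod ρ (w o) = minimalPeriod ρ o.out := by
    intro o
    by_cases ho : Odd (minimalPeriod ρ o.out)
    · simp only [w, if_pos ho]
      exact hκp o
    · simp only [w, if_neg ho]
      exact minimalPeriod_zpow_apply _ _ _
  have hout : ∀ z, ∃ n : ℤ, (ρ ^ n) (Quotient.mk (SameCycle.setoid ρ) z).out = z := fun z =>
    Quotient.mk_out (s := SameCycle.setoid ρ) z
  choose n hn using hout
  let m : Z → Z := fun z => (ρ ^ n z) (w (Quotient.mk _ z))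
  -- The chosen exponent `n z` does not matter, since `w o` and `o.out` have equal periods.
  have hm : ∀ (k : ℤ) (o : O), m ((ρ ^ k) o.out) = (ρ ^ k) (w o) := by
    intro k o
    have ho : Quotient.mk (SameCycle.setoid ρ) ((ρ ^ k) o.out) = o := by
      conv_rhs => rw [← Quotient.out_eq o]
      exact Quotient.sound (s := SameCycle.setoid ρ) (SameCycle.symm ⟨k, rfl⟩)
    have h1 := hn ((ρ ^ k) o.out)
    simp only [m]
    rw [ho] at h1 ⊢
    rw [zpow_apply_eq_zpow_apply_iff] at h1 ⊢
    rwa [hw]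
  have hmr : ∀ (k : ℤ) z, m ((ρ ^ k) z) = (ρ ^ k) (m z) := by
    intro k z
    conv_lhs => rw [← hn z, ← mul_apply, ← zpow_add, hm, zpow_add, mul_apply]
  have hmw : ∀ o, m (w o) = o.out := by
    intro o
    by_cases ho : Odd (minimalPeriod ρ o.out)
    · have h1 : w o = (κ o).out := if_pos ho
      have h2 := hm 0 (κ o)
      have h3 : w (κ o) = o.out := by
        have : w (κ o) = (κ (κ o)).out := if_pos (by rwa [hκp o])
        rw [this, hκ o]
      rw [zpow_zero, one_apply, one_apply, h3] at h2
      rw [h1, h2]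
    · have h1 : w o = (ρ ^ ((minimalPeriod ρ o.out / 2 : ℕ) : ℤ)) o.out := if_neg ho
      rw [h1, hm, h1, ← mul_apply, ← zpow_add, zpow_apply_eq_self_iff_minimalPeriod_dvd]
      rw [Nat.not_odd_iff_even] at ho
      exact ⟨1, by have := Nat.two_mul_div_two_of_even ho; omega⟩
  refine ⟨m, fun z => ?_, fun z hz => ?_, fun z => by simpa using hmr 1 z⟩
  · change m ((ρ ^ n z) _) = z
    rw [hmr, hmw, hn]
  -- A fixed point of `m` would make `w` fix a representative: in odd length a cycle would be its
  -- own partner, in even length the period would divide its positive half.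
  · have h1 : w (Quotient.mk _ z) = (Quotient.mk (SameCycle.setoid ρ) z).out :=
      (ρ ^ n z).injective (Eq.trans hz (hn z).symm)
    generalize Quotient.mk (SameCycle.setoid ρ) z = o at h1
    by_cases ho : Odd (minimalPeriod ρ o.out)
    · rw [show w o = (κ o).out from if_pos ho] at h1
      exact hκne o ho (Quotient.out_injective h1)
    · rw [show w o = (ρ ^ ((minimalPeriod ρ o.out / 2 : ℕ) : ℤ)) o.out from if_neg ho,
        zpow_apply_eq_self_iff_minimalPeriod_dvd, Int.natCast_dvd_natCast] at h1
      have hp := ρ.minimalPeriod_pos o.out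
      rw [Nat.not_odd_iff_even] at ho
      have := Nat.two_mul_div_two_of_even ho
      have := Nat.le_of_dvd (by omega) h1
      omega

open Classical in
/-- A permutation of a finite set commutes with a fixed-point-free involution if and only if it
has evenly many cycles of each odd length. -/
theorem exists_commuting_involution_iff :
    (∃ m : Z → Z, Involutive m ∧ (∀ z, m z ≠ z) ∧ ∀ z, m (ρ z) = ρ (m z)) ↔
      ∀ i, Odd i → Even (Finset.univ.filter fun z => minimalPeriod ρ z = i).card := by
  refine ⟨fun ⟨m, hm, hne, hc⟩ i _ => ?_, exists_commuting_involution ρ⟩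
  -- Commuting with `ρ`, the involution preserves periods and so restricts to the points of period
  -- `i`.
  refine Finset.even_card_of_involution _ m (fun z hz => ?_) (fun z _ => hm z) fun z _ => hne z
  have hz : minimalPeriod ρ z = i := by simpa using hz
  have hs : Semiconj m ρ ρ := hc
  simp only [Finset.mem_filter, Finset.mem_univ, true_and]
  rw [← hz]
  refine Nat.dvd_right_iff_eq.1 fun k => ?_
  rw [← isPeriodicPt_iff_minimalPeriod_dvd, ← isPeriodicPt_iff_minimalPeriod_dvd]
  refine ⟨fun h => ?_, fun h => ?_⟩
  · have := h.map hs
    rwa [hm z] at this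
  · exact h.map hs

end Involution

section Sum

variable {A B : Type*} [Fintype A] [Fintype B] [DecidableEq A] [DecidableEq B]

open Classical in
/-- The disjoint union of two permutations commutes with a fixed-point-free involution if and only
if the two have the same parity of the number of cycles of each odd length. -/
theorem exists_commuting_involution_sumCongr_iff (σ : Perm A) (τ : Perm B) :
    (∃ m : A ⊕ B → A ⊕ B, Involutive m ∧ (∀ z, m z ≠ z) ∧
        ∀ z, m (sumCongr σ τ z) = sumCongr σ τ (m z)) ↔
      ∀ i, Odd i → σ.partition.parts.count i ≡ τ.partition.parts.count i [MOD 2] := by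
  rw [exists_commuting_involution_iff]
  refine forall₂_congr fun i hi => ?_
  have hl : ∀ a, minimalPeriod (sumCongr σ τ) (Sum.inl a) = minimalPeriod σ a := fun a =>
    minimalPeriod_eq_minimalPeriod_iff.2 fun n => by
      rw [IsPeriodicPt, IsPeriodicPt, IsFixedPt, IsFixedPt,
        ← (Semiconj.iterate_right (f := Sum.inl) (ga := σ) (gb := sumCongr σ τ) (fun _ => rfl) n).eq,
        Sum.inl_injective.eq_iff]
  have hr : ∀ b, minimalPeriod (sumCongr σ τ) (Sum.inr b) = minimalPeriod τ b := fun a =>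
    minimalPeriod_eq_minimalPeriod_iff.2 fun n => by
      rw [IsPeriodicPt, IsPeriodicPt, IsFixedPt, IsFixedPt,
        ← (Semiconj.iterate_right (f := Sum.inr) (ga := τ) (gb := sumCongr σ τ) (fun _ => rfl) n).eq,
        Sum.inr_injective.eq_iff]
  have hcard : (Finset.univ.filter fun z => minimalPeriod (sumCongr σ τ) z = i).card =
      i * σ.partition.parts.count i + i * τ.partition.parts.count i := by
    rw [← card_minimalPeriod_eq, ← card_minimalPeriod_eq]
    simp only [Finset.card_filter, Fintype.sum_sum_type, hl, hr]
  -- Since `i` is odd, the factor `i` does not affect the parity of the sum of the two counts.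
  rw [hcard, ← mul_add, Nat.even_mul, Nat.even_iff, Nat.even_iff, Nat.ModEq]
  rw [Nat.odd_iff] at hi
  omega

end Sum

end Equiv.Perm

/-! ### Elements of the Brauer monoid as perfect matchings. -/

namespace PartitionMonoid

open Equiv (Perm)

section BrauerElements

variable {X : Type*} [Finite X]

lemma mem_brauer_iff {a : PartitionMonoid X} :
    a ∈ brauer X ↔ ∀ z, ∃! w, w ≠ z ∧ a.rel z w := by
  constructor
  · intro ha z
    obtain ⟨p, q, hpq, h⟩ := Set.ncard_eq_two.1 (ha _ (class_mem (a := a) z))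
    have hmem : ∀ w, a.rel w z ↔ w = p ∨ w = q := fun w => by
      simpa using Set.ext_iff.1 h w
    have hz := (hmem z).1 (a.rel.refl z)
    rcases hz with rfl | rfl
    · exact ⟨q, ⟨hpq.symm, a.rel.symm ((hmem q).2 (.inr rfl))⟩, fun w hw =>
        ((hmem w).1 (a.rel.symm hw.2)).resolve_left hw.1⟩
    · exact ⟨p, ⟨hpq, a.rel.symm ((hmem p).2 (.inl rfl))⟩, fun w hw =>
        ((hmem w).1 (a.rel.symm hw.2)).resolve_right hw.1⟩
  · rintro h _ ⟨z, rfl⟩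
    obtain ⟨w, ⟨hne, hw⟩, huniq⟩ := h z
    refine Set.ncard_eq_two.2 ⟨z, w, hne.symm, Set.ext fun v => ⟨fun hv => ?_, ?_⟩⟩
    · by_cases hvz : v = z
      · exact .inl hvz
      · exact .inr (huniq v ⟨hvz, a.rel.symm hv⟩)
    · rintro (rfl | rfl)
      · exact a.rel.refl _
      · exact a.rel.symm hw

lemma brauer_partner_unique {a : PartitionMonoid X} (ha : a ∈ brauer X) {z v w : X ⊕ X}
    (hv : a.rel z v) (hw : a.rel z w) (hzv : v ≠ z) (hzw : w ≠ z) : v = w :=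
  (mem_brauer_iff.1 ha z).unique ⟨hzv, hv⟩ ⟨hzw, hw⟩

/-- Elements of the Brauer monoid with a common pair in the block of each point agree. -/
lemma brauer_ext {a b : PartitionMonoid X} (ha : a ∈ brauer X) (hb : b ∈ brauer X)
    (h : ∀ z, ∃ w, w ≠ z ∧ a.rel z w ∧ b.rel z w) : a = b := by
  refine PartitionMonoid.ext_rel fun z w => ?_
  obtain ⟨v, hv, hav, hbv⟩ := h z
  by_cases hw : w = z
  · subst hw
    exact ⟨fun _ => b.rel.refl _, fun _ => a.rel.refl _⟩
  · constructor
    · intro h1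
      rwa [brauer_partner_unique ha h1 hav hw hv]
    · intro h1
      rwa [brauer_partner_unique hb h1 hbv hw hv]

/-- A perfect matching of `X ∪ X'` is the set of blocks of an element of the Brauer monoid. -/
lemma exists_brauer_of_matching (R : X ⊕ X → X ⊕ X → Prop) (hsymm : ∀ z w, R z w → R w z)
    (hirr : ∀ z, ¬ R z z) (h : ∀ z, ∃! w, R z w) :
    ∃ g ∈ brauer X, ∀ z w, R z w → g.rel z w := by
  refine ⟨⟨⟨fun z w => z = w ∨ R z w, fun z => .inl rfl, ?_, ?_⟩⟩, mem_brauer_iff.2 fun z => ?_,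
    fun z w h => .inr h⟩
  · rintro z w (rfl | h)
    · exact .inl rfl
    · exact .inr (hsymm _ _ h)
  · rintro z w v (rfl | h1) h2
    · exact h2
    · rcases h2 with rfl | h2
      · exact .inr h1
      · exact .inl ((h w).unique (hsymm _ _ h1) h2)
  · obtain ⟨w, hw, huniq⟩ := h z
    refine ⟨w, ⟨?_, .inr hw⟩, ?_⟩
    · rintro rfl
      exact hirr _ hw
    · rintro v ⟨hne, rfl | hv⟩
      · exact absurd rfl hne
      · exact huniq v hv

end BrauerElements

/-! ### Coordinates on the transversals, and intertwiners as matchings. -/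

section Frames

variable {X : Type*}

/-- The transversal blocks of a group element of the Brauer monoid: the class indexed by `P` has
one point `top P` in the domain and one point `bot P` in the codomain, and `σ` is the permutation
induced on the classes. -/
structure Frame (u : PartitionMonoid X) {A : Type*} (σ : Perm A) where
  /-- The point of the class in the domain. -/
  top : A → X
  /-- The point of the class in the codomain. -/
  bot : A → X
  top_injective : Function.Injective top
  bot_injective : Function.Injective bot
  join : ∀ P, u.kerJoin (top P) (bot P)
  link : ∀ P, u.rel (Sum.inl (top P)) (Sum.inr (bot (σ P)))
  top_of : ∀ x y, u.rel (Sum.inl x) (Sum.inr y) → ∃ P, top P = x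
  bot_of : ∀ x y, u.rel (Sum.inl x) (Sum.inr y) → ∃ P, bot P = y

/-- In a group element, transversals leaving one class have connected lower ends, and those entering
one class have connected upper ends. Blocks of size two leave room for one of each, so a class has a
single domain point and a single codomain point. -/
lemma nonempty_frame [Finite X] {u : PartitionMonoid X} (hu : u ∈ brauer X)
    (hg : IsGroupElement u) : Nonempty (Frame u (u.tau hg)) := by
  have hlink : ∀ P, u.Linked P (u.tau hg P) := fun P => (tau_eq_iff hg _ _).1 rfl
  have htop : ∀ P : u.TransversalClass, ∃ x, Quotient.mk u.kerJoin x = P.1 ∧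
      ∃ y, u.rel (Sum.inl x) (Sum.inr y) := by
    rintro ⟨P, x, y, h, hx⟩
    exact ⟨x, hx, y, h⟩
  have hbot : ∀ P : u.TransversalClass, ∃ y, Quotient.mk u.kerJoin y = P.1 ∧
      ∃ x, u.rel (Sum.inl x) (Sum.inr y) := by
    intro P
    -- The codomain point of `P` is the lower end of the transversal leaving the preimage of `P`
    -- under the permutation.
    obtain ⟨x, y, h, -, hy⟩ := hlink ((u.tau hg).symm P)
    rw [Equiv.apply_symm_apply] at hy
    exact ⟨y, hy, x, h⟩
  choose top htop1 htop2 using htop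
  choose bot hbot1 hbot2 using hbot
  have topU : ∀ x y P, u.rel (Sum.inl x) (Sum.inr y) → Quotient.mk u.kerJoin x = P.1 →
      top P = x := by
    intro x y P h hx
    obtain ⟨y', h'⟩ := htop2 P
    obtain ⟨e, v, hv⟩ := id hg
    -- Otherwise the upper points `x` and `top P` and the lower point `y` would be three points of
    -- one block.
    by_contra hne
    have hy := hv.lower_unique h h' (Quotient.exact (hx.trans (htop1 P).symm))
    have := brauer_partner_unique hu h (u.rel.trans h (u.rel.trans hy (u.rel.symm h'))) (by simp)
      (by simpa using hne)
    simp at this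
  have botU : ∀ x y P, u.rel (Sum.inl x) (Sum.inr y) → Quotient.mk u.kerJoin y = P.1 →
      bot P = y := by
    intro x y P h hy
    obtain ⟨x', h'⟩ := hbot2 P
    obtain ⟨e, v, hv⟩ := id hg
    by_contra hne
    have hx := hv.upper_unique h h' (Quotient.exact (hy.trans (hbot1 P).symm))
    have := brauer_partner_unique hu (u.rel.symm h)
      (u.rel.trans (u.rel.symm h) (u.rel.trans hx h')) (by simp) (by simpa using hne)
    simp at this
  refine ⟨⟨top, bot, fun P Q h => ?_, fun P Q h => ?_, fun P => ?_, fun P => ?_, fun x y h => ?_,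
    fun x y h => ?_⟩⟩
  · exact Subtype.ext ((htop1 P).symm.trans ((congrArg _ h).trans (htop1 Q)))
  · exact Subtype.ext ((hbot1 P).symm.trans ((congrArg _ h).trans (hbot1 Q)))
  · exact Quotient.exact ((htop1 P).trans (hbot1 P).symm)
  · obtain ⟨x, y, h, hx, hy⟩ := hlink P
    rwa [topU x y P h hx, botU x y _ h hy]
  · exact ⟨⟨_, x, y, h, rfl⟩, topU x y _ h rfl⟩
  · obtain ⟨e, v, hv⟩ := id hg
    obtain ⟨z, w, hz, hzw⟩ := hv.exists_next h
    exact ⟨⟨_, z, w, hzw, rfl⟩, botU x y _ h (Quotient.sound hz)⟩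

/-- The points that carry the transversal blocks of `u` in the upper row and those of `v` in the
lower row. -/
def Frame.point {u v : PartitionMonoid X} {A B : Type*} {σ : Perm A} {τ : Perm B}
    (F : Frame u σ) (G : Frame v τ) : A ⊕ B → X ⊕ X :=
  Sum.map F.top G.bot

/-- `g` contains the upper blocks of `u` and the lower blocks of `v`, and joins the remaining points
as prescribed by `m`. -/
structure Compatible {u v : PartitionMonoid X} {A B : Type*} {σ : Perm A} {τ : Perm B}
    (F : Frame u σ) (G : Frame v τ) (g : PartitionMonoid X) (m : A ⊕ B → A ⊕ B) : Prop where
  ker : ∀ x y, u.rel (Sum.inl x) (Sum.inl y) → g.rel (Sum.inl x) (Sum.inl y)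
  coker : ∀ x y, v.rel (Sum.inr x) (Sum.inr y) → g.rel (Sum.inr x) (Sum.inr y)
  point : ∀ p, g.rel (F.point G p) (F.point G (m p))

variable {u v : PartitionMonoid X} {A B : Type*} {σ : Perm A} {τ : Perm B}
  {F : Frame u σ} {G : Frame v τ} {g g' : PartitionMonoid X} {m m' : A ⊕ B → A ⊕ B}

lemma Frame.point_injective (F : Frame u σ) (G : Frame v τ) : Function.Injective (F.point G) :=
  F.top_injective.sumMap G.bot_injective

section Finite

variable [Finite X]

lemma Frame.exists_upper_partner (hu : u ∈ brauer X) (F : Frame u σ) {x : X}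
    (hx : ∀ P, F.top P ≠ x) : ∃ y, y ≠ x ∧ u.rel (Sum.inl x) (Sum.inl y) := by
  obtain ⟨w | w, ⟨hne, hw⟩, -⟩ := mem_brauer_iff.1 hu (Sum.inl x)
  · exact ⟨w, fun h => hne (congrArg _ h), hw⟩
  · exact absurd (F.top_of _ _ hw).choose_spec (hx _)

lemma Frame.exists_lower_partner (hv : v ∈ brauer X) (G : Frame v τ) {x : X}
    (hx : ∀ Q, G.bot Q ≠ x) : ∃ y, y ≠ x ∧ v.rel (Sum.inr x) (Sum.inr y) := by
  obtain ⟨w | w, ⟨hne, hw⟩, -⟩ := mem_brauer_iff.1 hv (Sum.inr x)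
  · exact absurd (G.bot_of _ _ (v.rel.symm hw)).choose_spec (hx _)
  · exact ⟨w, fun h => hne (congrArg _ h), hw⟩

lemma Frame.eq_of_rel_top (hu : u ∈ brauer X) (F : Frame u σ) {P : A} {x : X}
    (h : u.rel (Sum.inl (F.top P)) (Sum.inl x)) : x = F.top P := by
  by_contra hne
  have := brauer_partner_unique hu h (F.link P) (fun h => hne (Sum.inl_injective h)) (by simp)
  simp at this

lemma Frame.eq_of_rel_bot (hv : v ∈ brauer X) (G : Frame v τ) {Q : B} {x : X}
    (h : v.rel (Sum.inr (G.bot Q)) (Sum.inr x)) : x = G.bot Q := by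
  by_contra hne
  have h2 := G.link (τ.symm Q)
  rw [Equiv.apply_symm_apply] at h2
  have := brauer_partner_unique hv h (v.rel.symm h2)
    (fun h => hne (Sum.inr_injective h)) (by simp)
  simp at this

/-- A point outside the frames already has its partner in an upper block of `u` or a lower block of
`v`, so the matching of the frame points determines everything. -/
lemma Compatible.eq (hu : u ∈ brauer X) (hv : v ∈ brauer X) (hg : g ∈ brauer X)
    (hg' : g' ∈ brauer X) (h : Compatible F G g m) (h' : Compatible F G g' m)
    (hm : ∀ p, m p ≠ p) : g = g' := by
  refine brauer_ext hg hg' fun z => ?_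
  by_cases hz : ∃ p, F.point G p = z
  · obtain ⟨p, rfl⟩ := hz
    exact ⟨_, fun h => hm p (F.point_injective G h), h.point p, h'.point p⟩
  · rcases z with x | x
    · obtain ⟨y, hne, hy⟩ := F.exists_upper_partner hu (x := x) fun P hP =>
        hz ⟨Sum.inl P, congrArg Sum.inl hP⟩
      exact ⟨Sum.inl y, by simpa using hne, h.ker _ _ hy, h'.ker _ _ hy⟩
    · obtain ⟨y, hne, hy⟩ := G.exists_lower_partner hv (x := x) fun Q hQ =>
        hz ⟨Sum.inr Q, congrArg Sum.inr hQ⟩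
      exact ⟨Sum.inr y, by simpa using hne, h.coker _ _ hy, h'.coker _ _ hy⟩

lemma Compatible.matching_eq (hg : g ∈ brauer X) (h : Compatible F G g m)
    (h' : Compatible F G g m') (hm : ∀ p, m p ≠ p) (hm' : ∀ p, m' p ≠ p) : m = m' :=
  funext fun p => F.point_injective G (brauer_partner_unique hg (h.point p) (h'.point p)
    (fun h => hm p (F.point_injective G h)) fun h => hm' p (F.point_injective G h))

/-- The partner in `g` of a frame point is again a frame point, because all other points are used up
by the upper blocks of `u` and the lower blocks of `v`. -/
lemma exists_matching (hu : u ∈ brauer X) (hv : v ∈ brauer X) (hg : g ∈ brauer X)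
    (F : Frame u σ) (G : Frame v τ)
    (hker : ∀ x y, u.rel (Sum.inl x) (Sum.inl y) → g.rel (Sum.inl x) (Sum.inl y))
    (hcoker : ∀ x y, v.rel (Sum.inr x) (Sum.inr y) → g.rel (Sum.inr x) (Sum.inr y)) :
    ∃ m, Compatible F G g m ∧ Function.Involutive m ∧ ∀ p, m p ≠ p := by
  have hex : ∀ p, ∃ q, q ≠ p ∧ g.rel (F.point G p) (F.point G q) := by
    intro p
    obtain ⟨w, ⟨hne, hw⟩, -⟩ := mem_brauer_iff.1 hg (F.point G p)
    by_cases hz : ∃ q, F.point G q = w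
    · obtain ⟨q, rfl⟩ := hz
      exact ⟨q, fun h => hne (congrArg _ h), hw⟩
    exfalso
    rcases w with x | x
    · obtain ⟨y, hxy, hy⟩ := F.exists_upper_partner hu (x := x) fun P hP =>
        hz ⟨Sum.inl P, congrArg Sum.inl hP⟩
      have := brauer_partner_unique hg (g.rel.symm hw) (hker _ _ hy) hne.symm (by simpa using hxy)
      rcases p with P | Q
      · obtain rfl : F.top P = y := Sum.inl_injective this
        exact hxy (F.eq_of_rel_top hu (u.rel.symm hy)).symm
      · simp [Frame.point] at this
    · obtain ⟨y, hxy, hy⟩ := G.exists_lower_partner hv (x := x) fun Q hQ =>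
        hz ⟨Sum.inr Q, congrArg Sum.inr hQ⟩
      have := brauer_partner_unique hg (g.rel.symm hw) (hcoker _ _ hy) hne.symm
        (by simpa using hxy)
      rcases p with P | Q
      · simp [Frame.point] at this
      · obtain rfl : G.bot Q = y := Sum.inr_injective this
        exact hxy (G.eq_of_rel_bot hv (v.rel.symm hy)).symm
  choose m hne hm using hex
  refine ⟨m, ⟨hker, hcoker, hm⟩, fun p => F.point_injective G ?_, hne⟩
  exact brauer_partner_unique hg (hm (m p)) (g.rel.symm (hm p))
    (fun h => hne _ (F.point_injective G h)) fun h => hne p (F.point_injective G h).symm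

/-- Three matchings on disjoint sets are put together: `m` on the frame points, `u` on the rest of
the upper row, `v` on the rest of the lower row. -/
lemma exists_compatible (hu : u ∈ brauer X) (hv : v ∈ brauer X) (F : Frame u σ) (G : Frame v τ)
    (hm : Function.Involutive m) (hne : ∀ p, m p ≠ p) : ∃ g ∈ brauer X, Compatible F G g m := by
  let R : X ⊕ X → X ⊕ X → Prop := fun z w =>
    (∃ p, z = F.point G p ∧ w = F.point G (m p)) ∨
    (∃ x y, z = Sum.inl x ∧ w = Sum.inl y ∧ y ≠ x ∧ u.rel (Sum.inl x) (Sum.inl y)) ∨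
    ∃ x y, z = Sum.inr x ∧ w = Sum.inr y ∧ y ≠ x ∧ v.rel (Sum.inr x) (Sum.inr y)
  have hsymm : ∀ z w, R z w → R w z := by
    rintro z w (⟨p, rfl, rfl⟩ | ⟨x, y, rfl, rfl, hne, h⟩ | ⟨x, y, rfl, rfl, hne, h⟩)
    · exact .inl ⟨m p, rfl, by rw [hm p]⟩
    · exact .inr (.inl ⟨y, x, rfl, rfl, hne.symm, u.rel.symm h⟩)
    · exact .inr (.inr ⟨y, x, rfl, rfl, hne.symm, v.rel.symm h⟩)
  have hirr : ∀ z, ¬ R z z := by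
    rintro z (⟨p, h1, h2⟩ | ⟨x, y, rfl, h, hne, -⟩ | ⟨x, y, rfl, h, hne, -⟩)
    · exact hne p (F.point_injective G (h2.symm.trans h1))
    · exact hne (Sum.inl_injective h).symm
    · exact hne (Sum.inr_injective h).symm
  have hex : ∀ z, ∃! w, R z w := by
    intro z
    by_cases hz : ∃ p, F.point G p = z
    · obtain ⟨p, rfl⟩ := hz
      refine ⟨_, .inl ⟨p, rfl, rfl⟩, ?_⟩
      rintro w (⟨q, h, rfl⟩ | ⟨x, y, h, rfl, hne, hxy⟩ | ⟨x, y, h, rfl, hne, hxy⟩)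
      · rw [F.point_injective G h]
      · rcases p with P | Q
        · obtain rfl : F.top P = x := Sum.inl_injective h
          exact absurd (F.eq_of_rel_top hu hxy) hne
        · simp [Frame.point] at h
      · rcases p with P | Q
        · simp [Frame.point] at h
        · obtain rfl : G.bot Q = x := Sum.inr_injective h
          exact absurd (G.eq_of_rel_bot hv hxy) hne
    · rcases z with x | x
      · obtain ⟨y, hne, hy⟩ := F.exists_upper_partner hu (x := x) fun P hP =>
          hz ⟨Sum.inl P, congrArg Sum.inl hP⟩
        refine ⟨_, .inr (.inl ⟨x, y, rfl, rfl, hne, hy⟩), ?_⟩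
        rintro w (⟨q, h, rfl⟩ | ⟨x', y', h, rfl, hne', hxy⟩ | ⟨x', y', h, rfl, hne', hxy⟩)
        · exact absurd ⟨q, h.symm⟩ hz
        · obtain rfl := Sum.inl_injective h
          exact brauer_partner_unique hu hxy hy (by simpa using hne') (by simpa using hne)
        · simp at h
      · obtain ⟨y, hne, hy⟩ := G.exists_lower_partner hv (x := x) fun Q hQ =>
          hz ⟨Sum.inr Q, congrArg Sum.inr hQ⟩
        refine ⟨_, .inr (.inr ⟨x, y, rfl, rfl, hne, hy⟩), ?_⟩
        rintro w (⟨q, h, rfl⟩ | ⟨x', y', h, rfl, hne', hxy⟩ | ⟨x', y', h, rfl, hne', hxy⟩)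
        · exact absurd ⟨q, h.symm⟩ hz
        · simp at h
        · obtain rfl := Sum.inr_injective h
          exact brauer_partner_unique hv hxy hy (by simpa using hne') (by simpa using hne)
  obtain ⟨g, hg, hR⟩ := exists_brauer_of_matching R hsymm hirr hex
  refine ⟨g, hg, fun x y h => ?_, fun x y h => ?_, fun p => hR _ _ (.inl ⟨p, rfl, rfl⟩)⟩
  · by_cases hxy : y = x
    · subst hxy
      exact g.rel.refl _
    · exact hR _ _ (.inr (.inl ⟨x, y, rfl, rfl, hxy, h⟩))
  · by_cases hxy : y = x
    · subst hxy
      exact g.rel.refl _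
    · exact hR _ _ (.inr (.inr ⟨x, y, rfl, rfl, hxy, h⟩))

end Finite

/-- From `top P` the element `u` leads down to `bot (σ P)`, and the middle row joins this to `top (σ
P)`, where `g` takes over. Hence the matching is conjugated by `σ` on the first summand. -/
lemma Compatible.mul_left (h : Compatible F G g m) :
    Compatible F G (u * g)
      (Equiv.sumCongr σ.symm (Equiv.refl B) ∘ m ∘ Equiv.sumCongr σ (Equiv.refl B)) := by
  have path : ∀ p, stack u g (outer (F.point G (Equiv.sumCongr σ.symm (Equiv.refl B) p)))
      (lower (F.point G p)) := by
    rintro (P | Q)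
    · refine (stack u g).trans (stack_up (a := u) (b := g) (F.link (σ.symm P))) ?_
      rw [Equiv.apply_symm_apply]
      -- The class relation is generated by lower blocks of `u`, drawn above the middle row, and
      -- upper blocks of `u`, which `g` provides below it.
      refine kerJoin_induction (fun x => stack u g (Sum.inr (Sum.inl (F.bot P)))
        (Sum.inr (Sum.inl x))) ?_ ?_ (u.kerJoin.symm (F.join P)) ((stack u g).refl _)
      · exact fun x y hxy hx => (stack u g).trans hx (stack_low (a := u) (h.ker x y hxy))
      · exact fun x y hxy hx => (stack u g).trans hx (stack_up (b := g) hxy)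
    · exact (stack u g).refl _
  refine ⟨fun x y hxy => ker_mul hxy, fun x y hxy => coker_mul (h.coker x y hxy), fun p => ?_⟩
  have h1 := path (Equiv.sumCongr σ (Equiv.refl B) p)
  have h2 : Equiv.sumCongr σ.symm (Equiv.refl B) (Equiv.sumCongr σ (Equiv.refl B) p) = p := by
    cases p <;> simp
  rw [h2] at h1
  exact mul_rel.2 ((stack u g).trans h1 ((stack u g).trans (stack_low (h.point _))
    ((stack u g).symm (path _))))

/-- Mirror image: from `bot (τ Q)` the element `v` leads up to `top Q`, and the middle row joins
this to `bot Q`. The matching is conjugated by `τ` in the opposite sense, on the second summand. -/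
lemma Compatible.mul_right (h : Compatible F G g m) :
    Compatible F G (g * v)
      (Equiv.sumCongr (Equiv.refl A) τ ∘ m ∘ Equiv.sumCongr (Equiv.refl A) τ.symm) := by
  have path : ∀ p, stack g v (outer (F.point G (Equiv.sumCongr (Equiv.refl A) τ p)))
      (upper (F.point G p)) := by
    rintro (P | Q)
    · exact (stack g v).refl _
    · refine (stack g v).trans ((stack g v).symm (stack_low (a := g) (b := v) (G.link Q))) ?_
      refine kerJoin_induction (fun x => stack g v (Sum.inr (Sum.inl (G.top Q)))
        (Sum.inr (Sum.inl x))) ?_ ?_ (G.join Q) ((stack g v).refl _)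
      · exact fun x y hxy hx => (stack g v).trans hx (stack_low (a := g) hxy)
      · exact fun x y hxy hx => (stack g v).trans hx (stack_up (b := v) (h.coker x y hxy))
  refine ⟨fun x y hxy => ker_mul (h.ker x y hxy), fun x y hxy => coker_mul hxy, fun p => ?_⟩
  have h1 := path (Equiv.sumCongr (Equiv.refl A) τ.symm p)
  have h2 : Equiv.sumCongr (Equiv.refl A) τ (Equiv.sumCongr (Equiv.refl A) τ.symm p) = p := by
    cases p <;> simp
  rw [h2] at h1
  exact mul_rel.2 ((stack g v).trans h1 ((stack g v).trans (stack_up (h.point _))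
    ((stack g v).symm (path _))))

/-- `u` and `v` are intertwined by `g` if and only if the matching of `g` is invariant. -/
lemma Compatible.mul_eq_mul_iff [Finite X] (hu : u ∈ brauer X) (hv : v ∈ brauer X)
    (hg : g ∈ brauer X) (h : Compatible F G g m) (hne : ∀ p, m p ≠ p) :
    u * g = g * v ↔ ∀ p, m (Equiv.sumCongr σ τ p) = Equiv.sumCongr σ τ (m p) := by
  set s := Equiv.sumCongr σ (Equiv.refl B) with hs
  set t := Equiv.sumCongr (Equiv.refl A) τ with ht
  have hs' : Equiv.sumCongr σ.symm (Equiv.refl B) = s.symm := rfl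
  have ht' : Equiv.sumCongr (Equiv.refl A) τ.symm = t.symm := rfl
  have h1 := h.mul_left
  have h2 := h.mul_right
  rw [hs'] at h1
  rw [ht'] at h2
  have hne1 : ∀ p, (s.symm ∘ m ∘ s) p ≠ p := fun p hp =>
    hne (s p) ((Equiv.symm_apply_eq s).1 hp)
  have hne2 : ∀ p, (t ∘ m ∘ t.symm) p ≠ p := fun p hp =>
    hne (t.symm p) ((Equiv.eq_symm_apply t).2 hp)
  have hts : ∀ p, Equiv.sumCongr σ τ p = s (t p) := by rintro (P | Q) <;> rfl
  have key : u * g = g * v ↔ s.symm ∘ m ∘ s = t ∘ m ∘ t.symm := by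
    constructor
    · intro heq
      rw [← heq] at h2
      exact h1.matching_eq ((brauer X).mul_mem hu hg) h2 hne1 hne2
    · intro heq
      rw [← heq] at h2
      exact h1.eq hu hv ((brauer X).mul_mem hu hg) ((brauer X).mul_mem hg hv) h2 hne1
  -- Evaluating at `t p` instead of `p` removes `t.symm`; then `s` is moved across, and `s ∘ t` is
  -- `σ ⊕ τ`.
  rw [key, funext_iff, t.forall_congr_right.symm]
  refine forall_congr' fun p => ?_
  simp only [Function.comp_apply, Equiv.symm_apply_apply, Equiv.symm_apply_eq, hts]

end Frames

end PartitionMonoid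

/-! ### Reduction from `a` to `a^{ω+1}`. -/

section OmegaPowers

variable {M : Type*} [Monoid M] [Finite M]

lemma omegaPow_mul_self (a : M) : omegaPow a * omegaPow a = omegaPow a := by
  classical
  exact (Nat.find_spec (exists_idempotent_pow a)).2

/-- A common exponent for the idempotent powers of two elements. -/
lemma exists_pow_eq_omegaPow (a b : M) : ∃ k, a ^ k = omegaPow a ∧ b ^ k = omegaPow b := by
  classical
  obtain ⟨hi, ha⟩ := Nat.find_spec (exists_idempotent_pow a)
  obtain ⟨hj, hb⟩ := Nat.find_spec (exists_idempotent_pow b)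
  refine ⟨Nat.find (exists_idempotent_pow a) * Nat.find (exists_idempotent_pow b), ?_, ?_⟩
  · rw [pow_mul]
    exact ha.pow_eq hj.ne'
  · rw [mul_comm, pow_mul]
    exact hb.pow_eq hi.ne'

lemma omegaPow_commute (a : M) : Commute (omegaPow a) a := by
  obtain ⟨k, hk, -⟩ := exists_pow_eq_omegaPow a a
  exact hk ▸ Commute.pow_self a k

lemma omegaPow_mem (S : Submonoid M) {a : M} (ha : a ∈ S) : omegaPow a ∈ S := by
  obtain ⟨k, hk, -⟩ := exists_pow_eq_omegaPow a a
  exact hk ▸ S.pow_mem ha k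

/-- This serves to write the idempotent as a multiple of `a^{ω+1}` on either side. The witness is a
plain power of `a` and need not lie in the subgroup. -/
lemma exists_omegaSucc_mul_eq_omegaPow (a : M) :
    ∃ w, omegaSucc a * w = omegaPow a ∧ w * omegaSucc a = omegaPow a := by
  classical
  obtain ⟨k, hk⟩ := Nat.exists_eq_add_one_of_ne_zero (Nat.find_spec (exists_idempotent_pow a)).1.ne'
  have hk : omegaPow a = a ^ (k + 1) := by rw [← hk]; rfl
  refine ⟨a ^ k, ?_, ?_⟩
  · rw [omegaSucc, mul_assoc, ← pow_succ', ← hk, omegaPow_mul_self]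
  · rw [omegaSucc, (omegaPow_commute a).eq, ← mul_assoc, ← pow_succ, ← hk, omegaPow_mul_self]

/-- An intertwiner of `a` and `b` restricts to one of `a^{ω+1}` and `b^{ω+1}`. -/
lemma exists_intertwiner_omegaSucc (S : Submonoid M) {a b g : M} (ha : a ∈ S) (hg : g ∈ S)
    (h : a * g = g * b) : ∃ g ∈ S, omegaPow a * g = g ∧ g * omegaPow b = g ∧
      omegaSucc a * g = g * omegaSucc b := by
  -- Intertwining passes to powers, and a common exponent makes both powers idempotent at once.
  have hk : omegaPow a * g = g * omegaPow b := by
    obtain ⟨k, hka, hkb⟩ := exists_pow_eq_omegaPow a b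
    have hs : SemiconjBy g b a := h.symm
    rw [← hka, ← hkb]
    exact (hs.pow_right k).symm
  refine ⟨omegaPow a * g, S.mul_mem (omegaPow_mem S ha) hg,
    by rw [← mul_assoc, omegaPow_mul_self], by rw [hk, mul_assoc, omegaPow_mul_self], ?_⟩
  calc omegaSucc a * (omegaPow a * g) = omegaPow a * omegaPow a * (a * g) := by
        rw [omegaSucc, mul_assoc, ← mul_assoc a, ← (omegaPow_commute a).eq]
        simp only [mul_assoc]
    _ = omegaPow a * g * b := by rw [omegaPow_mul_self, h, mul_assoc]
    _ = omegaPow a * g * omegaSucc b := by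
        rw [omegaSucc, hk, mul_assoc g _ (omegaPow b * b), ← mul_assoc (omegaPow b),
          omegaPow_mul_self, mul_assoc]

/-- An intertwiner of `a^{ω+1}` and `b^{ω+1}` gives one of `a` and `b`. -/
lemma exists_intertwiner_of_omegaSucc (S : Submonoid M) {a b g : M} (ha : a ∈ S) (hb : b ∈ S)
    (hg : g ∈ S) (h : omegaSucc a * g = g * omegaSucc b) : ∃ g ∈ S, a * g = g * b := by
  -- On an element beginning with `a^ω`, left multiplication by `a` acts as `a^{ω+1}`; dually for
  -- `b` on the right.
  refine ⟨omegaPow a * g * omegaPow b,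
    S.mul_mem (S.mul_mem (omegaPow_mem S ha) hg) (omegaPow_mem S hb), ?_⟩
  have hl : ∀ c : M, omegaPow c * omegaSucc c = omegaSucc c := fun c => by
    rw [omegaSucc, ← mul_assoc, omegaPow_mul_self]
  have hr : omegaSucc b * omegaPow b = omegaSucc b := by
    rw [omegaSucc, mul_assoc, ← (omegaPow_commute b).eq, ← mul_assoc, omegaPow_mul_self]
  calc a * (omegaPow a * g * omegaPow b) = omegaSucc a * g * omegaPow b := by
        rw [omegaSucc, (omegaPow_commute a).eq]
        simp only [mul_assoc]
    _ = omegaSucc a * g := by rw [h, mul_assoc, hr]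
    _ = omegaPow a * (g * omegaSucc b) := by rw [← h, ← mul_assoc, hl]
    _ = omegaPow a * g * omegaPow b * b := by simp only [omegaSucc, mul_assoc]

end OmegaPowers

/-- In a submonoid, `∼_o` is decided by the existence of intertwiners in one direction. -/
lemma oConj_iff_of_symm {M : Type*} [Monoid M] (S : Submonoid M) (Q : M → M → Prop) (hQ : ∀ a b, Q a b → Q b a)
    (h : ∀ a ∈ S, ∀ b ∈ S, (∃ g ∈ S, a * g = g * b) ↔ Q a b) (a b : S) :
    OConj a b ↔ Q a b := by
  constructor
  · rintro ⟨g, -, hg, -⟩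
    exact (h a a.2 b b.2).1 ⟨g, g.2, congrArg Subtype.val hg⟩
  · intro hab
    obtain ⟨g, hg, hg'⟩ := (h a a.2 b b.2).2 hab
    obtain ⟨k, hk, hk'⟩ := (h b b.2 a a.2).2 (hQ _ _ hab)
    exact ⟨⟨g, hg⟩, ⟨k, hk⟩, Subtype.ext hg', Subtype.ext hk'⟩

/-! ### Conjugacy in the Brauer monoid. -/

namespace PartitionMonoid

section BrauerConjugacy

variable {X : Type*} [Finite X]

open Equiv.Perm in
/-- Two group elements of the Brauer monoid are intertwined by an element that extends their
kernel and cokernel if and only if the cycle counts of odd length have the same parities. -/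
lemma exists_intertwiner_iff_cycleCount {u v : PartitionMonoid X} (hu : u ∈ brauer X)
    (hv : v ∈ brauer X) (hgu : IsGroupElement u) (hgv : IsGroupElement v) :
    (∃ g ∈ brauer X, (∀ x y, u.rel (Sum.inl x) (Sum.inl y) → g.rel (Sum.inl x) (Sum.inl y)) ∧
      (∀ x y, v.rel (Sum.inr x) (Sum.inr y) → g.rel (Sum.inr x) (Sum.inr y)) ∧ u * g = g * v) ↔
      ∀ i, Odd i → cycleCount u hgu i ≡ cycleCount v hgv i [MOD 2] := by
  classical
  let _ := Fintype.ofFinite u.TransversalClass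
  let _ := Fintype.ofFinite v.TransversalClass
  obtain ⟨F⟩ := nonempty_frame hu hgu
  obtain ⟨G⟩ := nonempty_frame hv hgv
  have key := exists_commuting_involution_sumCongr_iff (u.tau hgu) (v.tau hgv)
  refine Iff.trans ⟨?_, ?_⟩ (key.trans ?_)
  · rintro ⟨g, hg, hker, hcoker, h⟩
    obtain ⟨m, hm, hinv, hne⟩ := exists_matching hu hv hg F G hker hcoker
    exact ⟨m, hinv, hne, (hm.mul_eq_mul_iff hu hv hg hne).1 h⟩
  · rintro ⟨m, hinv, hne, hc⟩
    obtain ⟨g, hg, hm⟩ := exists_compatible hu hv F G hinv hne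
    exact ⟨g, hg, hm.ker, hm.coker, (hm.mul_eq_mul_iff hu hv hg hne).2 hc⟩
  · refine forall₂_congr fun i _ => ?_
    -- The counts agree up to the choice of finiteness and decidability instances.
    unfold cycleCount
    convert Iff.rfl

lemma exists_brauer_intertwiner_iff {a b : PartitionMonoid X} (ha : a ∈ brauer X)
    (hb : b ∈ brauer X) :
    (∃ g ∈ brauer X, a * g = g * b) ↔ ∀ i, Odd i →
      cycleCount (omegaSucc a) (isGroupElement_omegaSucc a) i ≡
        cycleCount (omegaSucc b) (isGroupElement_omegaSucc b) i [MOD 2] := by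
  have haS : omegaSucc a ∈ brauer X := (brauer X).mul_mem (omegaPow_mem _ ha) ha
  have hbS : omegaSucc b ∈ brauer X := (brauer X).mul_mem (omegaPow_mem _ hb) hb
  rw [← exists_intertwiner_iff_cycleCount haS hbS]
  constructor
  · rintro ⟨g, hg, h⟩
    obtain ⟨g, hg, h1, h2, h⟩ := exists_intertwiner_omegaSucc _ ha hg h
    obtain ⟨a', ha', -⟩ := exists_omegaSucc_mul_eq_omegaPow a
    obtain ⟨b', -, hb'⟩ := exists_omegaSucc_mul_eq_omegaPow b
    refine ⟨g, hg, fun x y hxy => ?_, fun x y hxy => ?_, h⟩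
    -- As `g = a^ω g` and `a^ω` is a left multiple of something by `a^{ω+1}`, the element `g` begins
    -- with `a^{ω+1}` and inherits its upper blocks.
    · rw [← h1, ← ha']
      exact ker_mul (ker_mul hxy)
    · rw [← h2, ← hb']
      exact coker_mul (coker_mul hxy)
  · rintro ⟨g, hg, -, -, h⟩
    exact exists_intertwiner_of_omegaSucc _ ha hb hg h

end BrauerConjugacy

end PartitionMonoid

theorem theoremt (n : ℕ) :
    (∀ a b : PartitionMonoid.brauer (Fin n),
      OConj a b ↔ ∀ i : ℕ, Odd i →
        PartitionMonoid.cycleCount (omegaSucc (a : PartitionMonoid (Fin n)))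
            (isGroupElement_omegaSucc (a : PartitionMonoid (Fin n))) i ≡
          PartitionMonoid.cycleCount (omegaSucc (b : PartitionMonoid (Fin n)))
            (isGroupElement_omegaSucc (b : PartitionMonoid (Fin n))) i [MOD 2]) ∧
    (∀ a b : PartitionMonoid (Fin n), OConj a b) ∧
    (∀ a b : PartitionMonoid.partialBrauer (Fin n), OConj a b) :=
  ⟨oConj_iff_of_symm (PartitionMonoid.brauer (Fin n))
      (fun a b => ∀ i, Odd i →
        PartitionMonoid.cycleCount (omegaSucc a) (isGroupElement_omegaSucc a) i ≡
          PartitionMonoid.cycleCount (omegaSucc b) (isGroupElement_omegaSucc b) i [MOD 2])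
      (fun _ _ h i hi => (h i hi).symm)
      fun _ ha _ hb => PartitionMonoid.exists_brauer_intertwiner_iff ha hb,
    PartitionMonoid.oConj_partition, PartitionMonoid.oConj_partialBrauer⟩
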